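/- Let $d,s,\delta$ be positive integers with $2\delta\le s$, and suppose that $d=2$, or that $d\ge 3$ and $s=3\delta-2$. Let $\triangle^{\mathbb Z}_{d,s}=\{v\in\mathbb Z_{\ge 0}^{d+1}:\sum_i v_i=s\}$ and $r_i=s\,e_i$ for $i\in[d+1]$. The simplified simplex instance $\mathrm{SI}_{d,s,\delta}$ is the Steiner tree instance with terminal set $R=\{r_1,\dots,r_{d+1}\}$, edge costs $c(\{v,w\})=\|v-w\|_1$, and the graph $G$ whose vertex set is $V\cup R$, where $V=\{v\in\triangle^{\mathbb Z}_{d,s}\cup\triangle^{\mathbb Z}_{d,s+1}:\max_i v_i\le s-\delta\}$, and whose edges are the pairs $\{v,w\}\subseteq V$ with $\|v-w\|_1=1$ and the pairs $\{r_i,v\}$ with $v\in V\cap\triangle^{\mathbb Z}_{d,s}$ and $v_i=s-\delta$. The level of a vertex is the size of its support minus one, and the level of an edge is the maximum of the levels of its two ends. Then there is $u:E(G)\to\mathbb R_{\ge 0}$ such that: 1. (Bidirected cut relaxation.) For every root $r\in R$ there are values $x\ge 0$ on the arcs of the bidirected graph of $G$ with $x(v,w)+x(w,v)=u(\{v,w\})$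 for every edge $\{v,w\}$, and $x(\delta^-(U))\ge 1$ for every vertex set $U$ with $r\notin U$ and $U\cap R\ne\emptyset$. 2. (Flow form.) There are vertex balances $b:V\cup R\to\mathbb R$ with $b(r)=-1$ for all $r\in R$ and, for every $r\in R$, values $f_r\ge 0$ on the arcs with $f_r(v,w)+f_r(w,v)\le u(\{v,w\})$ for every edge $\{v,w\}$, and $f_r(\delta^+(v))-f_r(\delta^-(v))=b(v)+2\cdot[v=r]$ for every vertex $v$. 3. The usage $u(e)$ depends only on the level of $e$, and is zero unless that level is $1$ or $2$. 4. The cost is $$\sum_{e\in E(G)}c(e)\,u(e)=\begin{cases}3s+\dfrac32\cdot\dfrac{(s-\delta)(s-\delta+1)}{2s-3\delta+1}&\text{if }d=2,\\[2ex]\dfrac s3\left(5d+1+\dfrac{d-1}{s}\right)&\text{if }d\ge 3\text{ and }s=3\delta-2.\end{cases}$$ -/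

import Mathlib

noncomputable section

/-! ### Steiner tree instances and their bidirected relaxations -/

/-- A Steiner tree instance `(G, R, c)`: a finite undirected graph, a set of required vertices
(terminals) and nonnegative edge costs.  Values of `cost` off the edges are irrelevant. -/
structure SteinerInstance (V : Type*) [Fintype V] where
  graph : SimpleGraph V
  terminals : Finset V
  cost : Sym2 V → ℝ
  cost_nonneg : ∀ e ∈ graph.edgeSet, 0 ≤ cost e

section Relaxations

variable {V : Type*} [Fintype V]

open Classical in
/-- `f(δ⁺(U))`: the total value of `f` on the arcs of the bidirected graph leaving `U`. -/
def outValue (G : SimpleGraph V) (f : V → V → ℝ) (U : Finset V) : ℝ :=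
  ∑ v ∈ U, ∑ w ∈ Uᶜ, if G.Adj v w then f v w else 0

open Classical in
/-- `f(δ⁻(U))`: the total value of `f` on the arcs of the bidirected graph entering `U`. -/
def inValue (G : SimpleGraph V) (f : V → V → ℝ) (U : Finset V) : ℝ :=
  ∑ v ∈ Uᶜ, ∑ w ∈ U, if G.Adj v w then f v w else 0

open Classical in
/-- The cost `∑_{e ∈ E(G)} c(e) u(e)` of edge usages `u`. -/
def SteinerInstance.totalCost (I : SteinerInstance V) (u : Sym2 V → ℝ) : ℝ :=
  ∑ e ∈ I.graph.edgeFinset, I.cost e * u e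

/-- `x` is a feasible solution of the bidirected cut relaxation with root `r`: it is nonnegative on
the arcs, and every vertex set that avoids `r` and contains a terminal is entered by at least one
unit. -/
structure SteinerInstance.IsBCRSolution (I : SteinerInstance V) (r : V) (x : V → V → ℝ) :
    Prop where
  nonneg : ∀ v w, I.graph.Adj v w → 0 ≤ x v w
  cut : ∀ U : Finset V, r ∉ U → (∃ t ∈ I.terminals, t ∈ U) → 1 ≤ inValue I.graph x U

/-- The edge usages `u` are a feasible solution of the multi-root bidirected cut relaxation: for
every terminal `r`, the usages of the edges can be split among their two orientations so that a
feasible solution of the bidirected cut relaxation with root `r` arises. -/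
structure SteinerInstance.IsMBCRSolution (I : SteinerInstance V) (u : Sym2 V → ℝ) : Prop where
  nonneg : ∀ e ∈ I.graph.edgeSet, 0 ≤ u e
  split : ∀ r ∈ I.terminals, ∃ x : V → V → ℝ,
    I.IsBCRSolution r x ∧ ∀ v w, I.graph.Adj v w → x v w + x w v = u s(v, w)

/-- `f` is a bidirected balance-flow on `G` with respect to vertex balances `b` and
edge usages `u`. -/
structure IsBidirectedBalanceFlow (G : SimpleGraph V) (u : Sym2 V → ℝ) (b : V → ℝ)
    (f : V → V → ℝ) : Prop where
  nonneg : ∀ v w, G.Adj v w → 0 ≤ f v w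
  usage : ∀ v w, G.Adj v w → f v w + f w v ≤ u s(v, w)
  balance : ∀ v, outValue G f {v} - inValue G f {v} = b v

open Classical in
/-- `(u, b, f)` is a feasible solution of the flow form (balance-flow relaxation): one balance
function `b` serves all roots, and for every terminal `r`, `f r` is a bidirected balance-flow for
`u` and the balances `b_r(v) = b(v) + 2 ⟦v = r⟧`. -/
structure SteinerInstance.IsMBFRSolution (I : SteinerInstance V) (u : Sym2 V → ℝ) (b : V → ℝ)
    (f : V → V → V → ℝ) : Prop where
  nonneg : ∀ e ∈ I.graph.edgeSet, 0 ≤ u e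
  flow : ∀ r ∈ I.terminals,
    IsBidirectedBalanceFlow I.graph u (fun v => b v + if v = r then 2 else 0) (f r)

end Relaxations

/-! ### The simplified simplex instance -/

/-- The discrete simplex: points of `ℤ^{d+1}` with nonnegative coordinates that sum to `s`. -/
def discreteSimplex (d s : ℕ) : Finset (Fin (d + 1) → ℕ) :=
  Finset.piAntidiag Finset.univ s

/-- `‖v - w‖₁`. -/
def l1Dist {d : ℕ} (v w : Fin (d + 1) → ℕ) : ℤ :=
  ∑ i, |(v i : ℤ) - (w i : ℤ)|

theorem l1Dist_comm {d : ℕ} (v w : Fin (d + 1) → ℕ) : l1Dist v w = l1Dist w v :=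
  Finset.sum_congr rfl fun _ _ => abs_sub_comm _ _

theorem l1Dist_nonneg {d : ℕ} (v w : Fin (d + 1) → ℕ) : 0 ≤ l1Dist v w :=
  Finset.sum_nonneg fun _ _ => abs_nonneg _

/-- The level of a nonzero point: the size of its support minus one. -/
def level {d : ℕ} (v : Fin (d + 1) → ℕ) : ℕ :=
  (Finset.univ.filter fun i => v i ≠ 0).card - 1

/-- The points of the two discrete simplices of sizes `s` and `s + 1` with all coordinates at most
`s - δ`. -/
def innerVerts (d s δ : ℕ) : Finset (Fin (d + 1) → ℕ) :=
  (discreteSimplex d s ∪ discreteSimplex d (s + 1)).filter fun v => ∀ i, v i + δ ≤ s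

/-- The required vertex `r_i = s · e_i`, a corner of the simplex of size `s`. -/
def corner (d s : ℕ) (i : Fin (d + 1)) : Fin (d + 1) → ℕ :=
  Pi.single i s

/-- The required vertices `r_1, …, r_{d+1}`. -/
def corners (d s : ℕ) : Finset (Fin (d + 1) → ℕ) :=
  Finset.univ.image (corner d s)

/-- The vertices of the simplified simplex graph. -/
abbrev SimplexVertex (d s δ : ℕ) : Type :=
  {v : Fin (d + 1) → ℕ // v ∈ innerVerts d s δ ∪ corners d s}

/-- The simplified simplex graph: inner vertices at `L¹`-distance `1` are joined, and `r_i` is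
joined to the inner vertices of the simplex of size `s` whose `i`-th coordinate is `s - δ`. -/
def simplexGraph (d s δ : ℕ) : SimpleGraph (SimplexVertex d s δ) :=
  SimpleGraph.fromRel fun v w =>
    (v.1 ∈ innerVerts d s δ ∧ w.1 ∈ innerVerts d s δ ∧ l1Dist v.1 w.1 = 1) ∨
    (∃ i, v.1 = corner d s i ∧ w.1 ∈ discreteSimplex d s ∧ w.1 ∈ innerVerts d s δ ∧
      w.1 i + δ = s)

/-- The `L¹`-cost of an edge. -/
def l1Cost (d s δ : ℕ) : Sym2 (SimplexVertex d s δ) → ℝ :=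
  Sym2.lift ⟨fun v w => (l1Dist v.1 w.1 : ℝ),
    fun v w => congrArg (Int.cast : ℤ → ℝ) (l1Dist_comm v.1 w.1)⟩

/-- The level of an edge: the larger one of the levels of its two ends. -/
def edgeLevel {d s δ : ℕ} : Sym2 (SimplexVertex d s δ) → ℕ :=
  Sym2.lift ⟨fun v w => max (level v.1) (level w.1), fun _ _ => max_comm _ _⟩

/-- The simplified simplex instance of dimension `d` and size `s` with parameter `δ`. -/
def simplexInstance (d s δ : ℕ) : SteinerInstance (SimplexVertex d s δ) where
  graph := simplexGraph d s δ
  terminals := Finset.univ.filter fun v => v.1 ∈ corners d s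
  cost := l1Cost d s δ
  cost_nonneg := fun e _ => by
    induction e using Sym2.ind with
    | _ v w => exact Int.cast_nonneg (l1Dist_nonneg v.1 w.1)

end

/-! Put `m = s - δ` and `n = 2 * m - s + 1`. Orient every edge away from the simplex of size `s`:
from a point `P` in direction `l`, to `P + e_l`, or to the corner `r_l` if `P l = m`. Let `S` be the
support of `P` together with `l`. Up to one scaling factor, the usage of the edge is `n` if `|S| =
2`, `1` if `|S| = 3`, and `0` otherwise. The factor makes the total usage at each corner equal to
`1`.

The flow for the root `r` saturates every edge with `r ∈ S`: backwards in direction `r`, forwards in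
all other directions. If `r ∉ S` and `|S| = 2`, the arc carries the linear amount `2 * P l - s + 1`,
which equals the capacity `n` exactly where `P l = m`. If `r ∉ S` and `|S| = 3`, which can occur
only for `d ≥ 3`, then `s = 3 * n + 1` and `m = 2 * n`, and each point sends one unit in its unique
dominant direction.

Every non-corner vertex then has a balance that does not depend on `r` (`sum_arcFlow_insert`,
`sum_arcFlow_sub_single`). The arcs at a corner are saturated, inwards unless the corner is the root
(`arcFlow_of_eq_max`), so its balance is `-1`, or `1 = -1 + 2` at the root. Hence the flow form is
feasible.

The cut relaxation follows from the flow form with the same usages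
(`SteinerInstance.IsMBFRSolution.isMBCRSolution`). The cost is a count of lattice points by support:
edges between the two simplices have length `1`, and edges at corners have length `2 * δ`. -/

noncomputable section

/-! ### From the flow form to the cut relaxation -/

section Relaxations

variable {V : Type*} [Fintype V]

open Classical in
theorem outValue_sub_inValue_singleton (G : SimpleGraph V) (f : V → V → ℝ) (v : V) :
    outValue G f {v} - inValue G f {v} = ∑ w, if G.Adj v w then f v w - f w v else 0 := by
  have h : ∀ F : V → ℝ, ∑ w ∈ ({v} : Finset V)ᶜ, (if G.Adj v w then F w else 0) =
      ∑ w, if G.Adj v w then F w else 0 := fun F =>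
    Finset.sum_subset (Finset.subset_univ _) fun w _ hw => by
      have : w = v := by simpa using hw
      simp [this]
  simp only [outValue, inValue, Finset.sum_singleton, G.adj_comm _ v]
  rw [h, h, ← Finset.sum_sub_distrib]
  exact Finset.sum_congr rfl fun w _ => by split_ifs <;> simp

-- Summing the balances over `U`, the arcs inside `U` cancel by antisymmetry of the net flow, and
-- only the arcs across the cut remain.
open Classical in
theorem sum_outValue_sub_inValue (G : SimpleGraph V) (f : V → V → ℝ) (U : Finset V) :
    ∑ v ∈ U, (outValue G f {v} - inValue G f {v}) = outValue G f U - inValue G f U := by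
  simp only [outValue_sub_inValue_singleton]
  have hU : ∑ v ∈ U, ∑ w ∈ U, (if G.Adj v w then f v w - f w v else 0) = 0 := by
    have h : ∑ v ∈ U, ∑ w ∈ U, (if G.Adj v w then f v w - f w v else 0) =
        -∑ v ∈ U, ∑ w ∈ U, (if G.Adj v w then f v w - f w v else 0) := by
      conv_lhs => rw [Finset.sum_comm]
      simp only [← Finset.sum_neg_distrib]
      refine Finset.sum_congr rfl fun v _ => Finset.sum_congr rfl fun w _ => ?_
      simp only [G.adj_comm w v]
      split_ifs <;> simp
    linarith
  have hin : inValue G f U = ∑ v ∈ U, ∑ w ∈ Uᶜ, if G.Adj v w then f w v else 0 := by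
    rw [inValue, Finset.sum_comm]
    simp only [G.adj_comm]
  simp only [← Finset.sum_add_sum_compl U, Finset.sum_add_distrib, hU, zero_add]
  rw [hin, outValue, ← Finset.sum_sub_distrib]
  refine Finset.sum_congr rfl fun v _ => ?_
  rw [← Finset.sum_sub_distrib]
  exact Finset.sum_congr rfl fun w _ => by split_ifs <;> simp

/-- A feasible solution of the flow form gives one of the multi-root bidirected cut relaxation
with the same edge usages. -/
theorem SteinerInstance.IsMBFRSolution.isMBCRSolution {I : SteinerInstance V} {u : Sym2 V → ℝ}
    {b : V → ℝ} {f : V → V → V → ℝ} (h : I.IsMBFRSolution u b f) : I.IsMBCRSolution u := by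
  classical
  -- Each usage is split evenly and then shifted by half the net flow for `r`. The amount entering
  -- `U` is then half of `u(δ(U)) - b(U)`, since `r ∉ U`. The flow for a terminal `t ∈ U` has net
  -- outflow `b(U) + 2`, which is at most `u(δ(U))`, so this half is at least `1`.
  refine ⟨h.nonneg, fun r hr => ⟨fun v w => (u s(v, w) + f r v w - f r w v) / 2, ⟨?_, ?_⟩, ?_⟩⟩
  · intro v w hvw
    have h₁ := (h.flow r hr).usage v w hvw
    have h₂ := (h.flow r hr).nonneg v w hvw
    linarith
  · rintro U hrU ⟨t, ht, htU⟩
    set c : ℝ := ∑ v ∈ Uᶜ, ∑ w ∈ U, if I.graph.Adj v w then u s(v, w) else 0 with hc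
    have hx : inValue I.graph (fun v w => (u s(v, w) + f r v w - f r w v) / 2) U =
        (c + inValue I.graph (f r) U - outValue I.graph (f r) U) / 2 := by
      have hout : outValue I.graph (f r) U =
          ∑ v ∈ Uᶜ, ∑ w ∈ U, if I.graph.Adj v w then f r w v else 0 := by
        rw [outValue, Finset.sum_comm]
        simp only [I.graph.adj_comm]
      rw [hout, hc, inValue, inValue, ← Finset.sum_add_distrib, ← Finset.sum_sub_distrib,
        Finset.sum_div]
      refine Finset.sum_congr rfl fun v _ => ?_
      rw [← Finset.sum_add_distrib, ← Finset.sum_sub_distrib, Finset.sum_div]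
      exact Finset.sum_congr rfl fun w _ => by split_ifs <;> simp
    have hr' : outValue I.graph (f r) U - inValue I.graph (f r) U = ∑ v ∈ U, b v := by
      rw [← sum_outValue_sub_inValue]
      refine Finset.sum_congr rfl fun v hv => ?_
      rw [(h.flow r hr).balance, if_neg (ne_of_mem_of_not_mem hv hrU), add_zero]
    have ht' : outValue I.graph (f t) U - inValue I.graph (f t) U = ∑ v ∈ U, b v + 2 := by
      rw [← sum_outValue_sub_inValue]
      simp only [(h.flow t ht).balance, Finset.sum_add_distrib, Finset.sum_ite_eq', if_pos htU]
    have hle : outValue I.graph (f t) U ≤ c := by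
      rw [outValue, Finset.sum_comm, hc]
      refine Finset.sum_le_sum fun v _ => Finset.sum_le_sum fun w _ => ?_
      rw [I.graph.adj_comm]
      split_ifs with hvw
      · have h₁ := (h.flow t ht).usage v w hvw
        have h₂ := (h.flow t ht).nonneg v w hvw
        linarith
      · exact le_rfl
    have hnn : 0 ≤ inValue I.graph (f t) U :=
      Finset.sum_nonneg fun v _ => Finset.sum_nonneg fun w _ => by
        split_ifs with hvw
        · exact (h.flow t ht).nonneg v w hvw
        · exact le_rfl
    rw [hx]
    linarith
  · intro v w _
    simp only [Sym2.eq_swap (a := w) (b := v)]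
    ring

end Relaxations

/-! ### Flows given by signed values on oriented edges -/

section Arcs

variable {V : Type*}

/-- An enumeration of the edges of a graph by oriented arcs, one for each edge. -/
structure ArcSystem (G : SimpleGraph V) (A : Type*) where
  src : A → V
  tgt : A → V
  adj : ∀ a, G.Adj (src a) (tgt a)
  inj : ∀ a a', s(src a, tgt a) = s(src a', tgt a') → a = a'
  surj : ∀ v w, G.Adj v w → ∃ a, s(src a, tgt a) = s(v, w)

namespace ArcSystem

variable {G : SimpleGraph V} {A : Type*} [Fintype A] (X : ArcSystem G A)

open Classical in
/-- The flow on the bidirected graph with net value `γ a` along the arc `a`. -/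
def flow (γ : A → ℝ) (v w : V) : ℝ :=
  ∑ a, ((if X.src a = v ∧ X.tgt a = w then max (γ a) 0 else 0) +
    (if X.src a = w ∧ X.tgt a = v then max (-γ a) 0 else 0))

theorem flow_nonneg (γ : A → ℝ) (v w : V) : 0 ≤ X.flow γ v w :=
  Finset.sum_nonneg fun a _ => by split_ifs <;> positivity

open Classical in
theorem flow_sub_flow (γ : A → ℝ) (v w : V) :
    X.flow γ v w - X.flow γ w v =
      ∑ a, ((if X.src a = v ∧ X.tgt a = w then γ a else 0) -
        (if X.src a = w ∧ X.tgt a = v then γ a else 0)) := by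
  rw [flow, flow, ← Finset.sum_sub_distrib]
  refine Finset.sum_congr rfl fun a _ => ?_
  have := max_zero_sub_max_neg_zero_eq_self (γ a)
  split_ifs <;> linarith

-- By `inj` no other arc joins the same two vertices, so only the positive and the negative part of
-- `γ a` contribute, and they add up to `|γ a|`.
open Classical in
theorem flow_add_flow (γ : A → ℝ) (a : A) :
    X.flow γ (X.src a) (X.tgt a) + X.flow γ (X.tgt a) (X.src a) = |γ a| := by
  rw [flow, flow, ← Finset.sum_add_distrib, Finset.sum_eq_single a]
  · have h : ¬(X.src a = X.tgt a ∧ X.tgt a = X.src a) := fun h => (X.adj a).ne h.1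
    rw [if_pos ⟨rfl, rfl⟩, if_neg h]
    rcases le_total 0 (γ a) with h0 | h0
    · simp [h, h0, abs_of_nonneg h0]
    · simp [h, h0, abs_of_nonpos h0]
  · intro a' _ hne
    have h₁ : ¬(X.src a' = X.src a ∧ X.tgt a' = X.tgt a) := fun h =>
      hne (X.inj _ _ (by rw [h.1, h.2]))
    have h₂ : ¬(X.src a' = X.tgt a ∧ X.tgt a' = X.src a) := fun h =>
      hne (X.inj _ _ (by rw [h.1, h.2, Sym2.eq_swap]))
    simp [h₁, h₂]
  · simp

variable [Fintype V]

open Classical in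
theorem sum_adj_flow_sub_flow (γ : A → ℝ) (v : V) :
    (∑ w, if G.Adj v w then X.flow γ v w - X.flow γ w v else 0) =
      (∑ a, if X.src a = v then γ a else 0) - ∑ a, if X.tgt a = v then γ a else 0 := by
  have h : ∀ w, (if G.Adj v w then X.flow γ v w - X.flow γ w v else 0) =
      ∑ a, ((if X.src a = v ∧ X.tgt a = w then γ a else 0) -
        (if X.src a = w ∧ X.tgt a = v then γ a else 0)) := fun w => by
    split_ifs with hvw
    · exact X.flow_sub_flow γ v w
    · refine (Finset.sum_eq_zero fun a _ => ?_).symm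
      rw [if_neg, if_neg, sub_zero]
      · rintro ⟨rfl, rfl⟩
        exact hvw (X.adj a).symm
      · rintro ⟨rfl, rfl⟩
        exact hvw (X.adj a)
  simp only [h]
  rw [Finset.sum_comm, ← Finset.sum_sub_distrib]
  refine Finset.sum_congr rfl fun a _ => ?_
  rw [Finset.sum_sub_distrib]
  congr 1
  · simp [ite_and]
  · simp [ite_and]

open Classical in
theorem isBidirectedBalanceFlow {u : Sym2 V → ℝ} {b : V → ℝ} {γ : A → ℝ}
    (hu : ∀ a, |γ a| ≤ u s(X.src a, X.tgt a))
    (hb : ∀ v, (∑ a, if X.src a = v then γ a else 0) - (∑ a, if X.tgt a = v then γ a else 0) =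
      b v) :
    IsBidirectedBalanceFlow G u b (X.flow γ) where
  nonneg v w _ := X.flow_nonneg γ v w
  usage v w hvw := by
    obtain ⟨a, ha⟩ := X.surj v w hvw
    rw [← ha]
    refine le_trans (le_of_eq ?_) (hu a)
    rcases Sym2.eq_iff.1 ha with ⟨rfl, rfl⟩ | ⟨rfl, rfl⟩
    · exact X.flow_add_flow γ a
    · rw [add_comm, X.flow_add_flow γ a]
  balance v := by
    rw [outValue_sub_inValue_singleton, X.sum_adj_flow_sub_flow, hb]

open Classical in
theorem sum_edgeFinset (F : Sym2 V → ℝ) :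
    ∑ e ∈ G.edgeFinset, F e = ∑ a, F s(X.src a, X.tgt a) := by
  symm
  refine Finset.sum_bij (fun a _ => s(X.src a, X.tgt a)) (fun a _ => ?_)
    (fun a _ a' _ => X.inj a a') (fun e he => ?_) (fun _ _ => rfl)
  · simpa using X.adj a
  · induction e using Sym2.ind with
    | _ v w =>
      obtain ⟨a, ha⟩ := X.surj v w (by simpa using he)
      exact ⟨a, Finset.mem_univ a, ha⟩

end ArcSystem

end Arcs

/-! ### Dominant directions in a triangle -/

/-- In a triangle of side length `3n + 1` whose coordinates are at most `2n`, the direction `l`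
at `P` is dominant if `P l - n` exceeds the other coordinates of `P - n` in absolute value, where
negative values win ties. -/
def IsDominant {ι : Type*} (n : ℤ) (S : Set ι) (P : ι → ℤ) (l : ι) : Prop :=
  (∀ k ∈ S, k ≠ l → -(P l - n) < P k - n ∧ P k < P l) ∨
    (∀ k ∈ S, k ≠ l → P l < P k ∧ P k - n ≤ -(P l - n))

theorem ite_add_ite_add_ite_eq_one {p q r : Prop} [Decidable p] [Decidable q] [Decidable r]
    (h : p ∨ q ∨ r) (hpq : ¬(p ∧ q)) (hpr : ¬(p ∧ r)) (hqr : ¬(q ∧ r)) :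
    ((if p then 1 else 0) + (if q then 1 else 0) + (if r then 1 else 0) : ℤ) = 1 := by
  split_ifs <;> simp_all

section Triple

variable {ι : Type*} [DecidableEq ι] {i j k : ι}

theorem isDominant_triple (hij : i ≠ j) (hik : i ≠ k) (hjk : j ≠ k) (n : ℤ) (P : ι → ℤ) :
    (IsDominant n (({i, j, k} : Finset ι) : Set ι) P i ↔
      (-(P i - n) < P j - n ∧ P j < P i ∧ -(P i - n) < P k - n ∧ P k < P i) ∨
      (P i < P j ∧ P j - n ≤ -(P i - n) ∧ P i < P k ∧ P k - n ≤ -(P i - n))) ∧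
    (IsDominant n (({i, j, k} : Finset ι) : Set ι) P j ↔
      (-(P j - n) < P i - n ∧ P i < P j ∧ -(P j - n) < P k - n ∧ P k < P j) ∨
      (P j < P i ∧ P i - n ≤ -(P j - n) ∧ P j < P k ∧ P k - n ≤ -(P j - n))) ∧
    (IsDominant n (({i, j, k} : Finset ι) : Set ι) P k ↔
      (-(P k - n) < P i - n ∧ P i < P k ∧ -(P k - n) < P j - n ∧ P j < P k) ∨
      (P k < P i ∧ P i - n ≤ -(P k - n) ∧ P k < P j ∧ P j - n ≤ -(P k - n))) := by
  simp [IsDominant, hij, hik, hjk, hij.symm, hik.symm, hjk.symm, and_assoc]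

open Classical in
/-- Every lattice point of the smaller triangle has exactly one dominant direction. -/
theorem sum_isDominant_eq_one {S : Finset ι} (hS : S.card = 3) {n : ℤ} {P : ι → ℤ}
    (hP : ∑ l ∈ S, P l = 3 * n + 1) :
    ∑ l ∈ S, (if IsDominant n (S : Set ι) P l then 1 else 0 : ℤ) = 1 := by
  obtain ⟨i, j, k, hij, hik, hjk, rfl⟩ := Finset.card_eq_three.1 hS
  have hi : i ∉ ({j, k} : Finset ι) := by simp [hij, hik]
  have hj : j ∉ ({k} : Finset ι) := by simp [hjk]
  rw [Finset.sum_insert hi, Finset.sum_insert hj, Finset.sum_singleton] at hP ⊢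
  obtain ⟨h₁, h₂, h₃⟩ := isDominant_triple hij hik hjk n P
  rw [← add_assoc]
  -- The three differences `P - n` have sum `1`. If two of them are equal and of largest absolute
  -- value, they must be `1, 1, -1`, and there the negative one wins. Ties of opposite sign also go
  -- to the negative one, so exactly one direction is dominant.
  apply ite_add_ite_add_ite_eq_one <;> simp only [h₁, h₂, h₃] <;> omega

open Classical in
/-- Every lattice point of the larger triangle is reached in its dominant direction by exactly one
of its neighbors. -/
theorem sum_isDominant_sub_single_eq_one {S : Finset ι} (hS : S.card = 3) {n : ℤ} {Q : ι → ℤ}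
    (hQ : ∑ l ∈ S, Q l = 3 * n + 2) :
    ∑ l ∈ S, (if IsDominant n (S : Set ι) (Q - Pi.single l 1) l then 1 else 0 : ℤ) = 1 := by
  obtain ⟨i, j, k, hij, hik, hjk, rfl⟩ := Finset.card_eq_three.1 hS
  have hi : i ∉ ({j, k} : Finset ι) := by simp [hij, hik]
  have hj : j ∉ ({k} : Finset ι) := by simp [hjk]
  rw [Finset.sum_insert hi, Finset.sum_insert hj, Finset.sum_singleton] at hQ ⊢
  have h₁ := (isDominant_triple hij hik hjk n (Q - Pi.single i 1)).1
  have h₂ := (isDominant_triple hij hik hjk n (Q - Pi.single j 1)).2.1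
  have h₃ := (isDominant_triple hij hik hjk n (Q - Pi.single k 1)).2.2
  simp only [Pi.sub_apply, Pi.single_eq_same, Pi.single_eq_of_ne hij, Pi.single_eq_of_ne hij.symm,
    Pi.single_eq_of_ne hik, Pi.single_eq_of_ne hik.symm, Pi.single_eq_of_ne hjk,
    Pi.single_eq_of_ne hjk.symm] at h₁ h₂ h₃
  rw [← add_assoc]
  -- The reflection `Q ↦ 2 * n + 1 - Q` sends the sum `3 * n + 2` to `3 * n + 1` and turns the
  -- condition in direction `l` into dominance of `l` at the reflected point, so this is the
  -- previous count in disguise.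
  apply ite_add_ite_add_ite_eq_one <;> simp only [h₁, h₂, h₃] <;> omega

end Triple
-- The flow for one root and its balances
/-- The usage, up to scaling, of the edges whose larger end has a support of size `c`. -/
def supportWeight (n : ℤ) (c : ℕ) : ℤ :=
  if c = 2 then n else if c = 3 then 1 else 0

section ArcFlow

variable {ι : Type*} [DecidableEq ι]

open Classical in
/-- The flow for the root `r`, up to scaling, from the point `P` of the simplex of size `s` in
direction `l`, where `S` is the support of `P` together with `l`. -/
def arcFlow (n s : ℤ) (r : ι) (S : Finset ι) (P : ι → ℤ) (l : ι) : ℤ :=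
  if l = r then -supportWeight n S.card
  else if r ∈ S then supportWeight n S.card
  -- The slope `2` makes the two arcs that enter a point of the larger simplex cancel. The constant
  -- makes the value `n` at `P l = m`.
  else if S.card = 2 then 2 * P l - s + 1
  else if S.card = 3 ∧ IsDominant n (S : Set ι) P l then 1
  else 0

variable {n s : ℤ} {r : ι} {S : Finset ι}

/-- One arc runs backwards and `|S| - 1` arcs run forwards, all at capacity, which leaves `|S| - 2`
times the weight. The values do not depend on the points, so `F` may vary with the direction and the
lemma serves both simplices. -/
theorem sum_arcFlow_of_mem (hr : r ∈ S) (F : ι → ι → ℤ) :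
    ∑ l ∈ S, arcFlow n s r S (F l) l = if S.card = 3 then 1 else 0 := by
  have h : ∀ l ∈ S.erase r, arcFlow n s r S (F l) l = supportWeight n S.card := fun l hl => by
    rw [arcFlow, if_neg (Finset.ne_of_mem_erase hl), if_pos hr]
  rw [← Finset.add_sum_erase S _ hr, Finset.sum_congr rfl h, Finset.sum_const,
    Finset.card_erase_of_mem hr, arcFlow, if_pos rfl, supportWeight]
  split_ifs with h₂ h₃ h₃
  · omega
  · simp [h₂]
  · simp [h₃]
  · simp

theorem sum_arcFlow_of_two {P : ι → ℤ} (hr : r ∉ S) (hS : S.card = 2) (hP : ∑ l ∈ S, P l = s) :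
    ∑ l ∈ S, arcFlow n s r S P l = 2 := by
  have h : ∀ l ∈ S, arcFlow n s r S P l = 2 * P l - s + 1 := fun l hl => by
    rw [arcFlow, if_neg (ne_of_mem_of_not_mem hl hr), if_neg hr, if_pos hS]
  rw [Finset.sum_congr rfl h, Finset.sum_add_distrib, Finset.sum_sub_distrib, ← Finset.mul_sum, hP]
  simp only [Finset.sum_const, hS]
  ring

theorem sum_arcFlow_of_three {P : ι → ℤ} (h3 : r ∉ S → s = 3 * n + 1) (hS : S.card = 3)
    (hP : ∑ l ∈ S, P l = s) :
    ∑ l ∈ S, arcFlow n s r S P l = 1 := by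
  classical
  by_cases hr : r ∈ S
  · rw [sum_arcFlow_of_mem hr (fun _ => P), if_pos hS]
  · have h : ∀ l ∈ S, arcFlow n s r S P l = if IsDominant n (S : Set ι) P l then 1 else 0 :=
      fun l hl => by
        rw [arcFlow, if_neg (ne_of_mem_of_not_mem hl hr), if_neg hr, if_neg (by omega)]
        simp [hS]
    rw [Finset.sum_congr rfl h, sum_isDominant_eq_one hS (by rw [hP, h3 hr])]

theorem arcFlow_of_three_lt {P : ι → ℤ} {l : ι} (hS : 3 < S.card) : arcFlow n s r S P l = 0 := by
  have h₂ : S.card ≠ 2 := by omega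
  have h₃ : S.card ≠ 3 := by omega
  simp [arcFlow, supportWeight, h₂, h₃]

/-- The balance at a point of the simplex of size `s + 1` with support `S`. -/
theorem sum_arcFlow_sub_single {Q : ι → ℤ} (h3 : r ∉ S → S.card = 3 → s = 3 * n + 1)
    (hQ : ∑ l ∈ S, Q l = s + 1) :
    ∑ l ∈ S, arcFlow n s r S (Q - Pi.single l 1) l = if S.card = 3 then 1 else 0 := by
  classical
  by_cases hr : r ∈ S
  · exact sum_arcFlow_of_mem hr _
  by_cases hS2 : S.card = 2
  · have h : ∀ l ∈ S, arcFlow n s r S (Q - Pi.single l 1) l = 2 * Q l - s - 1 := fun l hl => by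
      rw [arcFlow, if_neg (ne_of_mem_of_not_mem hl hr), if_neg hr, if_pos hS2]
      simp only [Pi.sub_apply, Pi.single_eq_same]
      ring
    rw [Finset.sum_congr rfl h, Finset.sum_sub_distrib, Finset.sum_sub_distrib, ← Finset.mul_sum,
      hQ]
    simp only [Finset.sum_const, hS2]
    simp
    ring
  have h : ∀ l ∈ S, arcFlow n s r S (Q - Pi.single l 1) l =
      if S.card = 3 ∧ IsDominant n (S : Set ι) (Q - Pi.single l 1) l then 1 else 0 := fun l hl => by
    rw [arcFlow, if_neg (ne_of_mem_of_not_mem hl hr), if_neg hr, if_neg hS2]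
  rw [Finset.sum_congr rfl h]
  split_ifs with hS3
  · simp only [true_and, hS3]
    exact sum_isDominant_sub_single_eq_one hS3 (by rw [hQ, h3 hr hS3]; ring)
  · simp [hS3]

/-- The balance at a point of the simplex of size `s` with support `S`. -/
theorem sum_arcFlow_insert [Fintype ι] {m : ℤ} {P : ι → ℤ}
    (hι : Fintype.card ι = 3 ∨ (s = 3 * n + 1 ∧ m = 2 * n)) (hS : 2 ≤ S.card)
    (hPS : ∀ l, 0 ≤ P l) (hmem : ∀ l, l ∈ S ↔ P l ≠ 0) (hm : ∀ l, P l ≤ m)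
    (hP : ∑ l, P l = s) :
    ∑ l, arcFlow n s r (insert l S) P l =
      if S.card = 2 then (Fintype.card ι : ℤ) - 2 else if S.card = 3 then 1 else 0 := by
  classical
  have hPsum : ∑ l ∈ S, P l = s := by
    rw [← hP]
    exact Finset.sum_subset (Finset.subset_univ S) fun l _ hl => by
      by_contra h
      exact hl ((hmem l).2 h)
  have hin : ∑ l ∈ S, arcFlow n s r (insert l S) P l = ∑ l ∈ S, arcFlow n s r S P l :=
    Finset.sum_congr rfl fun l hl => by rw [Finset.insert_eq_of_mem hl]
  rw [← Finset.sum_add_sum_compl S, hin]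
  split_ifs with hS2 hS3
  · have hc : ∀ l ∈ Sᶜ, (insert l S).card = 3 := fun l hl => by
      rw [Finset.card_insert_of_notMem (Finset.mem_compl.1 hl), hS2]
    have hcard : (Sᶜ.card : ℤ) = Fintype.card ι - 2 := by
      rw [Finset.card_compl, hS2, Nat.cast_sub (hS2 ▸ Finset.card_le_univ S)]
      rfl
    by_cases hr : r ∈ S
    · have h : ∀ l ∈ Sᶜ, arcFlow n s r (insert l S) P l = 1 := fun l hl => by
        rw [arcFlow, if_neg (ne_of_mem_of_not_mem hr (Finset.mem_compl.1 hl)).symm,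
          if_pos (Finset.mem_insert_of_mem hr), hc l hl]
        rfl
      rw [sum_arcFlow_of_mem hr (fun _ => P), Finset.sum_congr rfl h, if_neg (by omega)]
      simp only [Finset.sum_const, nsmul_eq_mul, hcard]
      ring
    · have hrc : r ∈ Sᶜ := Finset.mem_compl.2 hr
      have h : ∀ l ∈ Sᶜ.erase r, arcFlow n s r (insert l S) P l = 1 := fun l hl => by
        have hlS : l ∉ S := Finset.mem_compl.1 (Finset.mem_of_mem_erase hl)
        have hlr := Finset.ne_of_mem_erase hl
        have hcl := hc l (Finset.mem_of_mem_erase hl)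
        have hr' : r ∉ insert l S := by simp [hlr.symm, hr]
        -- Two directions `l ≠ r` outside the two-element `S` need at least four coordinates, so the
        -- case `s = 3 * n + 1` applies.
        have hmn : m = 2 * n := by
          rcases hι with h | h
          · have := Finset.card_le_univ (insert r (insert l S))
            rw [Finset.card_insert_of_notMem hr', hcl, h] at this
            omega
          · exact h.2
        have hl0 : P l = 0 := by
          by_contra h
          exact hlS ((hmem l).2 h)
        rw [arcFlow, if_neg hlr, if_neg hr', if_neg (by omega), if_pos]
        -- Here `P l - n = -n`, while the other two coordinates lie between `1` and `2 * n`. If one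
        -- of them equals `2 * n`, there is a tie, and this is where negative values have to win.
        refine ⟨hcl, Or.inr fun k hk hkl => ?_⟩
        have hkS : k ∈ S := by
          rcases Finset.mem_insert.1 (Finset.mem_coe.1 hk) with h | h
          · exact absurd h hkl
          · exact h
        have h₁ := (hmem k).1 hkS
        have h₂ := hPS k
        have h₃ := hm k
        omega
      rw [sum_arcFlow_of_two hr hS2 hPsum, ← Finset.add_sum_erase _ _ hrc,
        Finset.sum_congr rfl h, arcFlow, if_pos rfl, hc r hrc, Finset.sum_const,
        Finset.card_erase_of_mem hrc, nsmul_eq_mul,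
        Nat.cast_sub (Finset.card_pos.2 ⟨r, hrc⟩), hcard]
      -- The two arcs inside `S` give `2`, direction `r` gives `-1`, and each remaining direction
      -- gives `1`. The total agrees with the case `r ∈ S`.
      simp [supportWeight]
      ring
  · have h : ∀ l ∈ Sᶜ, arcFlow n s r (insert l S) P l = 0 := fun l hl => by
      apply arcFlow_of_three_lt
      rw [Finset.card_insert_of_notMem (Finset.mem_compl.1 hl)]
      omega
    rw [Finset.sum_congr rfl h, sum_arcFlow_of_three _ hS3 hPsum]
    · simp
    · intro hr
      rcases hι with h | h
      · have := Finset.card_le_univ (insert r S)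
        rw [Finset.card_insert_of_notMem hr] at this
        omega
      · exact h.1
  · have h : ∀ l ∈ Sᶜ, arcFlow n s r (insert l S) P l = 0 := fun l hl => by
      apply arcFlow_of_three_lt
      rw [Finset.card_insert_of_notMem (Finset.mem_compl.1 hl)]
      omega
    rw [Finset.sum_congr rfl h, Finset.sum_congr rfl fun l _ => arcFlow_of_three_lt (by omega)]
    simp

/-- The arcs to the corners are used to capacity, away from the root. -/
theorem arcFlow_of_eq_max [Fintype ι] {m : ℤ} {P : ι → ℤ} {l : ι}
    (hι : Fintype.card ι = 3 ∨ (s = 3 * n + 1 ∧ m = 2 * n)) (hn : n = 2 * m - s + 1) (hn1 : 1 ≤ n)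
    (hPS : ∀ l, 0 ≤ P l) (hmem : ∀ l, l ∈ S ↔ P l ≠ 0) (hm : ∀ l, P l ≤ m)
    (hP : ∑ l, P l = s) (hl : P l = m) (hlr : l ≠ r) :
    arcFlow n s r S P l = supportWeight n S.card := by
  classical
  rw [arcFlow, if_neg hlr]
  split_ifs with hr h₂ h₃ <;> rw [supportWeight]
  · rw [if_pos h₂, hl, hn]
  · simp [h₃.1]
  · rw [if_neg h₂, if_neg]
    refine fun hS => h₃ ⟨hS, Or.inl ?_⟩
    obtain ⟨rfl, rfl⟩ : s = 3 * n + 1 ∧ m = 2 * n := by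
      refine hι.resolve_left fun h => ?_
      have := Finset.card_le_univ (insert r S)
      rw [Finset.card_insert_of_notMem hr] at this
      omega
    have hlS : l ∈ S := (hmem l).2 (by omega)
    intro k hk hkl
    have hk0 := (hmem k).1 hk
    have := hPS k
    have := hm k
    -- The third point of the support has a positive coordinate. With `P l = 2 * n` this gives `P k
    -- ≤ n`, hence `l` is dominant with a positive value.
    have hlt : P l + P k < 3 * n + 1 := by
      obtain ⟨j, hj⟩ : (S \ {l, k}).Nonempty := by
        rw [← Finset.card_pos, Finset.card_sdiff_of_subset
          (by simp [Finset.insert_subset_iff, hlS, Finset.mem_coe.1 hk]),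
          Finset.card_pair hkl.symm, hS]
        norm_num
      simp only [Finset.mem_sdiff, Finset.mem_insert, Finset.mem_singleton, not_or] at hj
      have hj0 := (hmem j).1 hj.1
      have hj1 := hPS j
      have := Finset.sum_le_univ_sum_of_nonneg (s := {l, k, j}) hPS
      rw [Finset.sum_insert (by simp [hkl.symm, Ne.symm hj.2.1]),
        Finset.sum_pair (Ne.symm hj.2.2), hP] at this
      omega
    omega

/-- The flow respects the usages. -/
theorem abs_arcFlow_le [Fintype ι] {m : ℤ} {P : ι → ℤ} {l : ι}
    (hn : n = 2 * m - s + 1) (hn1 : 1 ≤ n)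
    (hmem : ∀ k, k ≠ l → k ∉ S → P k = 0) (hl : l ∈ S) (hm : ∀ l, P l ≤ m)
    (hP : ∑ l, P l = s) :
    |arcFlow n s r S P l| ≤ supportWeight n S.card := by
  classical
  have h0 : 0 ≤ supportWeight n S.card := by
    rw [supportWeight]
    split_ifs <;> omega
  rw [arcFlow]
  split_ifs with hr hr h₂ h₃
  · rw [abs_neg, abs_of_nonneg h0]
  · rw [abs_of_nonneg h0]
  · rw [supportWeight, if_pos h₂]
    -- Both coordinates on `S` are at most `m` and their sum is `s`, so `2 * P l - s + 1` lies
    -- between `2 - n` and `n`.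
    have hSs : ∑ k ∈ S, P k = s := by
      rw [← hP]
      exact Finset.sum_subset (Finset.subset_univ S) fun k _ hk =>
        hmem k (ne_of_mem_of_not_mem hl hk).symm hk
    obtain ⟨k, hk⟩ : ∃ k, S.erase l = {k} := by
      rw [← Finset.card_eq_one, Finset.card_erase_of_mem hl, h₂]
    rw [← Finset.add_sum_erase S _ hl, hk, Finset.sum_singleton] at hSs
    have := hm l
    have := hm k
    rw [abs_le]
    omega
  · simp [supportWeight, h₃.1]
  · simpa using h0

end ArcFlow

/-! ### Counting lattice points by support -/

section Counting

variable {d : ℕ}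

/-- The support of a lattice point. -/
def pointSupport (v : Fin (d + 1) → ℕ) : Finset (Fin (d + 1)) :=
  Finset.univ.filter fun i => v i ≠ 0

@[simp]
theorem mem_pointSupport {v : Fin (d + 1) → ℕ} {i : Fin (d + 1)} :
    i ∈ pointSupport v ↔ v i ≠ 0 := by
  simp [pointSupport]

theorem pointSupport_eq_iff {v : Fin (d + 1) → ℕ} {S : Finset (Fin (d + 1))} :
    pointSupport v = S ↔ ∀ i, v i ≠ 0 ↔ i ∈ S := by
  simp [Finset.ext_iff]

theorem sum_pointSupport (v : Fin (d + 1) → ℕ) : ∑ i ∈ pointSupport v, v i = ∑ i, v i :=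
  Finset.sum_subset (Finset.subset_univ _) fun i _ hi => by simpa using hi

/-- The points of the discrete simplex of size `N` with all coordinates at most `m`. -/
def boundedSimplex (d N m : ℕ) : Finset (Fin (d + 1) → ℕ) :=
  (discreteSimplex d N).filter fun v => ∀ i, v i ≤ m

theorem mem_boundedSimplex {N m : ℕ} {v : Fin (d + 1) → ℕ} :
    v ∈ boundedSimplex d N m ↔ ∑ i, v i = N ∧ ∀ i, v i ≤ m := by
  simp [boundedSimplex, discreteSimplex]

theorem card_filter_card_pointSupport {B : Finset (Fin (d + 1) → ℕ)} {c N : ℕ}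
    (𝒮 : Finset (Finset (Fin (d + 1)))) (hB : ∀ v ∈ B, (pointSupport v).card = c →
      pointSupport v ∈ 𝒮) (h𝒮 : ∀ S ∈ 𝒮, S.card = c)
    (hN : ∀ S ∈ 𝒮, (B.filter fun v => pointSupport v = S).card = N) :
    (B.filter fun v => (pointSupport v).card = c).card = 𝒮.card * N := by
  rw [Finset.card_eq_sum_card_fiberwise (f := pointSupport) (t := 𝒮)
    (fun v hv => hB v (Finset.mem_filter.1 hv).1 (Finset.mem_filter.1 hv).2),
    Finset.sum_const_nat]
  intro S hS
  rw [← hN S hS, Finset.filter_filter]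
  congr 1
  refine Finset.filter_congr fun v _ => ⟨fun h => h.2, fun h => ⟨?_, h⟩⟩
  rw [h, h𝒮 S hS]

theorem card_filter_mem_powersetCard {ι : Type*} [Fintype ι] [DecidableEq ι] (i : ι) (c : ℕ) :
    ((Finset.powersetCard (c + 1) (Finset.univ : Finset ι)).filter fun S => i ∈ S).card =
      (Fintype.card ι - 1).choose c := by
  rw [← Finset.card_univ, ← Finset.card_erase_of_mem (Finset.mem_univ i),
    ← Finset.card_powersetCard]
  refine Finset.card_nbij' (fun S => S.erase i) (fun S => insert i S) ?_ ?_ ?_ ?_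
  · intro S hS
    simp only [Finset.coe_filter, Finset.mem_powersetCard, Set.mem_ofPred_eq] at hS
    simp only [Finset.mem_coe, Finset.mem_powersetCard]
    exact ⟨Finset.erase_subset_erase i hS.1.1, by rw [Finset.card_erase_of_mem hS.2, hS.1.2]; rfl⟩
  · intro S hS
    simp only [Finset.mem_coe, Finset.mem_powersetCard] at hS
    have hi : i ∉ S := fun h => by simpa using hS.1 h
    simp [Finset.card_insert_of_notMem hi, hS.2]
  · intro S hS
    exact Finset.insert_erase (Finset.mem_filter.1 hS).2
  · intro S hS
    simp only [Finset.mem_coe, Finset.mem_powersetCard] at hS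
    exact Finset.erase_insert fun h => by simpa using hS.1 h

/-- The point with the coordinates `a` and `b` at `i` and `j`. -/
def pairPoint (i j : Fin (d + 1)) (a b : ℕ) (x : Fin (d + 1)) : ℕ :=
  if x = i then a else if x = j then b else 0

/-- The point with the coordinates `a`, `b` and `c` at `i`, `j` and `k`. -/
def triplePoint (i j k : Fin (d + 1)) (a b c : ℕ) (x : Fin (d + 1)) : ℕ :=
  if x = i then a else if x = j then b else if x = k then c else 0

theorem forall_of_forall_triple {p : Fin (d + 1) → Prop} {i j k : Fin (d + 1)} (hi : p i)
    (hj : p j) (hk : p k) (h : ∀ x, x ≠ i → x ≠ j → x ≠ k → p x) (x : Fin (d + 1)) : p x := by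
  by_cases h₁ : x = i
  · exact h₁ ▸ hi
  by_cases h₂ : x = j
  · exact h₂ ▸ hj
  by_cases h₃ : x = k
  · exact h₃ ▸ hk
  exact h x h₁ h₂ h₃

theorem mem_boundedSimplex_pair {N m : ℕ} {i j : Fin (d + 1)} (hij : i ≠ j)
    {v : Fin (d + 1) → ℕ} :
    v ∈ boundedSimplex d N m ∧ pointSupport v = {i, j} ↔
      v i + v j = N ∧ v i ≤ m ∧ v j ≤ m ∧ 0 < v i ∧ 0 < v j ∧ v = pairPoint i j (v i) (v j) := by
  constructor
  · rintro ⟨hv, hS⟩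
    obtain ⟨hsum, hm⟩ := mem_boundedSimplex.1 hv
    rw [← sum_pointSupport, hS, Finset.sum_pair hij] at hsum
    rw [pointSupport_eq_iff] at hS
    have hi := (hS i).2 (by simp)
    have hj := (hS j).2 (by simp)
    refine ⟨hsum, hm i, hm j, by omega, by omega, funext fun x => ?_⟩
    have := hS x
    rw [pairPoint]
    split_ifs with h₁ h₂
    · rw [h₁]
    · rw [h₂]
    · simpa [h₁, h₂] using this
  · rintro ⟨hN, h₁, h₂, h₃, h₄, h⟩
    have h0 : ∀ x, x ≠ i → x ≠ j → v x = 0 := fun x h₁ h₂ => by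
      rw [h, pairPoint, if_neg h₁, if_neg h₂]
    have hS : pointSupport v = {i, j} := by
      rw [pointSupport_eq_iff]
      refine forall_of_forall_triple (i := i) (j := j) (k := j) ?_ ?_ ?_ ?_
      · simp [h₃.ne']
      · simp [h₄.ne']
      · simp [h₄.ne']
      · intro x h₁ h₂ _
        simp [h0 x h₁ h₂, h₁, h₂]
    refine ⟨mem_boundedSimplex.2 ⟨?_, ?_⟩, hS⟩
    · rw [← sum_pointSupport, hS, Finset.sum_pair hij, hN]
    · exact forall_of_forall_triple h₁ h₂ h₂ fun x h₁ h₂ _ => by simp [h0 x h₁ h₂]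

theorem mem_boundedSimplex_triple {N m : ℕ} {i j k : Fin (d + 1)} (hij : i ≠ j) (hik : i ≠ k)
    (hjk : j ≠ k) {v : Fin (d + 1) → ℕ} :
    v ∈ boundedSimplex d N m ∧ pointSupport v = {i, j, k} ↔
      v i + v j + v k = N ∧ v i ≤ m ∧ v j ≤ m ∧ v k ≤ m ∧ 0 < v i ∧ 0 < v j ∧ 0 < v k ∧
        v = triplePoint i j k (v i) (v j) (v k) := by
  have hsum3 : ∑ x ∈ ({i, j, k} : Finset (Fin (d + 1))), v x = v i + v j + v k := by
    rw [Finset.sum_insert (by simp [hij, hik]), Finset.sum_pair hjk, add_assoc]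
  constructor
  · rintro ⟨hv, hS⟩
    obtain ⟨hsum, hm⟩ := mem_boundedSimplex.1 hv
    rw [← sum_pointSupport, hS, hsum3] at hsum
    rw [pointSupport_eq_iff] at hS
    have hi := (hS i).2 (by simp)
    have hj := (hS j).2 (by simp)
    have hk := (hS k).2 (by simp)
    refine ⟨hsum, hm i, hm j, hm k, by omega, by omega, by omega, funext fun x => ?_⟩
    have := hS x
    rw [triplePoint]
    split_ifs with h₁ h₂ h₃
    · rw [h₁]
    · rw [h₂]
    · rw [h₃]
    · simpa [h₁, h₂, h₃] using this
  · rintro ⟨hN, h₁, h₂, h₃, h₄, h₅, h₆, h⟩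
    have h0 : ∀ x, x ≠ i → x ≠ j → x ≠ k → v x = 0 := fun x h₁ h₂ h₃ => by
      rw [h, triplePoint, if_neg h₁, if_neg h₂, if_neg h₃]
    have hS : pointSupport v = {i, j, k} := by
      rw [pointSupport_eq_iff]
      refine forall_of_forall_triple (i := i) (j := j) (k := k) ?_ ?_ ?_ ?_
      · simp [h₄.ne']
      · simp [h₅.ne']
      · simp [h₆.ne']
      · intro x h₁ h₂ h₃
        simp [h0 x h₁ h₂ h₃, h₁, h₂, h₃]
    refine ⟨mem_boundedSimplex.2 ⟨?_, ?_⟩, hS⟩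
    · rw [← sum_pointSupport, hS, hsum3, hN]
    · exact forall_of_forall_triple h₁ h₂ h₃ fun x h₁ h₂ h₃ => by simp [h0 x h₁ h₂ h₃]

/-- The number of points with a prescribed support of size two. -/
theorem card_boundedSimplex_pair {s m δ : ℕ} (hm : m + δ = s) (hδ : δ ≤ m)
    {S : Finset (Fin (d + 1))} (hS : S.card = 2) :
    ((boundedSimplex d (s + 1) m).filter fun v => pointSupport v = S).card = m - δ := by
  obtain ⟨i, j, hij, rfl⟩ := Finset.card_eq_two.1 hS
  rw [← Finset.card_range (m - δ)]
  have hmem : ∀ v, v ∈ (boundedSimplex d (s + 1) m).filter (fun v => pointSupport v = {i, j}) ↔ _ :=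
    fun v => Finset.mem_filter.trans (mem_boundedSimplex_pair hij)
  -- The two coordinates have sum `m + δ + 1` and are at most `m`, so `v i` runs from `δ + 1` to
  -- `m`.
  refine Finset.card_bij (fun v _ => v i - (δ + 1)) (fun v hv => ?_) (fun v hv w hw h => ?_)
    (fun a ha => ?_)
  · have := (hmem v).1 hv
    rw [Finset.mem_range]
    omega
  · obtain ⟨h₁, h₂, h₃, h₄, h₅, h₆⟩ := (hmem v).1 hv
    obtain ⟨g₁, g₂, g₃, g₄, g₅, g₆⟩ := (hmem w).1 hw
    rw [h₆, g₆, show v i = w i by omega, show v j = w j by omega]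
  · rw [Finset.mem_range] at ha
    refine ⟨pairPoint i j (δ + 1 + a) (m - a), (hmem _).2 ?_, ?_⟩
    · have h₁ : pairPoint i j (δ + 1 + a) (m - a) i = δ + 1 + a := by simp [pairPoint]
      have h₂ : pairPoint i j (δ + 1 + a) (m - a) j = m - a := by simp [pairPoint, hij.symm]
      rw [h₁, h₂]
      refine ⟨?_, ?_, ?_, ?_, ?_, rfl⟩ <;> omega
    · simp [pairPoint]

theorem card_boundedSimplex_triple_eq {s m : ℕ} {S : Finset (Fin (d + 1))} (hS : S.card = 3) :
    ((boundedSimplex d (s + 1) m).filter fun v => pointSupport v = S).card =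
      ((Finset.range m ×ˢ Finset.range m).filter fun p =>
        p.1 + p.2 + 2 ≤ s ∧ s ≤ p.1 + p.2 + 1 + m).card := by
  obtain ⟨i, j, k, hij, hik, hjk, rfl⟩ := Finset.card_eq_three.1 hS
  have hmem : ∀ v, v ∈ (boundedSimplex d (s + 1) m).filter
      (fun v => pointSupport v = {i, j, k}) ↔ _ :=
    fun v => Finset.mem_filter.trans (mem_boundedSimplex_triple hij hik hjk)
  refine Finset.card_bij (fun v _ => (v i - 1, v j - 1)) (fun v hv => ?_)
    (fun v hv w hw h => ?_) (fun p hp => ?_)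
  · have := (hmem v).1 hv
    simp only [Finset.mem_filter, Finset.mem_product, Finset.mem_range]
    omega
  · obtain ⟨h₁, h₂, h₃, h₄, h₅, h₆, h₇, h₈⟩ := (hmem v).1 hv
    obtain ⟨g₁, g₂, g₃, g₄, g₅, g₆, g₇, g₈⟩ := (hmem w).1 hw
    rw [Prod.mk.injEq] at h
    rw [h₈, g₈, show v i = w i by omega, show v j = w j by omega, show v k = w k by omega]
  · simp only [Finset.mem_filter, Finset.mem_product, Finset.mem_range] at hp
    obtain ⟨a, b⟩ := p
    dsimp only at hp
    refine ⟨triplePoint i j k (a + 1) (b + 1) (s - 1 - a - b), (hmem _).2 ?_, ?_⟩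
    · have h₁ : triplePoint i j k (a + 1) (b + 1) (s - 1 - a - b) i = a + 1 := by
        simp [triplePoint]
      have h₂ : triplePoint i j k (a + 1) (b + 1) (s - 1 - a - b) j = b + 1 := by
        simp [triplePoint, hij.symm]
      have h₃ : triplePoint i j k (a + 1) (b + 1) (s - 1 - a - b) k = s - 1 - a - b := by
        simp [triplePoint, hik.symm, hjk.symm]
      rw [h₁, h₂, h₃]
      refine ⟨?_, ?_, ?_, ?_, ?_, ?_, ?_, rfl⟩ <;> omega
    · simp [triplePoint, hij.symm]

theorem two_mul_sum_range_cast (k : ℕ) : 2 * ∑ i ∈ Finset.range k, (i : ℤ) = k * (k - 1) := by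
  induction k with
  | zero => simp
  | succ k ih =>
    rw [Finset.sum_range_succ, mul_add, ih]
    push_cast
    ring

theorem two_mul_card_filter_range_product {s m δ : ℕ} (hm : m + δ = s) (hδ : δ ≤ m) :
    2 * (((Finset.range m ×ˢ Finset.range m).filter fun p =>
        p.1 + p.2 + 2 ≤ s ∧ s ≤ p.1 + p.2 + 1 + m).card : ℤ) =
      s * (s - 1) - 3 * δ * (δ - 1) := by
  obtain ⟨t, rfl⟩ := Nat.exists_eq_add_of_le hδ
  -- With `m = δ + t`, the region is cut into columns. In the first `δ` columns only the lower bound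
  -- on `b` matters beyond `b < m`; in the other `t` columns only the upper bound does.
  have h₁ : ∀ a ∈ Finset.range δ, ((Finset.range (δ + t)).filter fun b =>
      a + b + 2 ≤ s ∧ s ≤ a + b + 1 + (δ + t)).card = t + 1 + a := fun a ha => by
    have : ((Finset.range (δ + t)).filter fun b => a + b + 2 ≤ s ∧ s ≤ a + b + 1 + (δ + t)) =
        Finset.Ico (δ - 1 - a) (δ + t) := by
      ext b
      simp only [Finset.mem_filter, Finset.mem_range, Finset.mem_Ico] at ha ⊢
      omega
    rw [this, Nat.card_Ico]
    rw [Finset.mem_range] at ha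
    omega
  have h₂ : ∀ a ∈ Finset.range t, (((Finset.range (δ + t)).filter fun b =>
      δ + a + b + 2 ≤ s ∧ s ≤ δ + a + b + 1 + (δ + t)).card : ℤ) = δ + t - 1 - a := fun a ha => by
    have : ((Finset.range (δ + t)).filter fun b =>
        δ + a + b + 2 ≤ s ∧ s ≤ δ + a + b + 1 + (δ + t)) = Finset.range (δ + t - 1 - a) := by
      ext b
      simp only [Finset.mem_filter, Finset.mem_range] at ha ⊢
      omega
    rw [this, Finset.card_range]
    rw [Finset.mem_range] at ha
    omega
  have hs : (s : ℤ) = 2 * δ + t := by omega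
  rw [Finset.card_filter, Finset.sum_product]
  simp only [← Finset.card_filter]
  rw [Finset.sum_range_add, Finset.sum_congr rfl h₁, Nat.cast_add, Nat.cast_sum, Nat.cast_sum,
    Finset.sum_congr rfl h₂]
  have e₁ := two_mul_sum_range_cast δ
  have e₂ := two_mul_sum_range_cast t
  push_cast
  simp only [Finset.sum_add_distrib, Finset.sum_sub_distrib, Finset.sum_const, Finset.card_range,
    nsmul_eq_mul, hs]
  linear_combination e₁ - e₂

/-- Only supports of sizes two and three have nonzero weight. `F` stands for the multiplicity of a
point: its number of incoming arcs in the larger simplex, and `1` at a corner. -/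
theorem sum_supportWeight (B : Finset (Fin (d + 1) → ℕ)) (n : ℤ) (F : ℕ → ℤ) :
    ∑ v ∈ B, F (pointSupport v).card * supportWeight n (pointSupport v).card =
      (B.filter fun v => (pointSupport v).card = 2).card * (F 2 * n) +
        (B.filter fun v => (pointSupport v).card = 3).card * F 3 := by
  rw [Finset.card_filter, Finset.card_filter, Nat.cast_sum, Nat.cast_sum, Finset.sum_mul,
    Finset.sum_mul, ← Finset.sum_add_distrib]
  refine Finset.sum_congr rfl fun v _ => ?_
  rw [supportWeight]
  split_ifs with h₂ h₃ h₃
  · omega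
  · simp [h₂]
  · simp [h₃]
  · simp

/-- The total weight of the edges at the points of the larger simplex. -/
theorem sum_upper_supportWeight {s m δ : ℕ} (hm : m + δ = s) (hδ : δ ≤ m) (n : ℤ) :
    2 * ∑ v ∈ boundedSimplex d (s + 1) m,
        ((pointSupport v).card : ℤ) * supportWeight n (pointSupport v).card =
      4 * n * ((d + 1).choose 2 * (s - 2 * δ)) +
        3 * ((d + 1).choose 3 * (s * (s - 1) - 3 * δ * (δ - 1))) := by
  rw [sum_supportWeight _ n (fun c => (c : ℤ)),
    card_filter_card_pointSupport (N := m - δ) (Finset.powersetCard 2 Finset.univ),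
    card_filter_card_pointSupport (Finset.powersetCard 3 Finset.univ) _ _
      fun S hS => card_boundedSimplex_triple_eq (Finset.mem_powersetCard.1 hS).2,
    Finset.card_powersetCard, Finset.card_powersetCard, Finset.card_univ, Fintype.card_fin]
  · have h := two_mul_card_filter_range_product hm hδ
    have hs : (s : ℤ) - 2 * δ = ((m - δ : ℕ) : ℤ) := by omega
    rw [hs, ← h]
    push_cast
    ring
  all_goals simp +contextual [Finset.mem_powersetCard]
  exact fun S hS => card_boundedSimplex_pair hm hδ hS

/-- The total weight of the edges at a corner. -/
theorem sum_lower_supportWeight {s m δ : ℕ} (hm : m + δ = s) (hδ : δ ≤ m) (hδ1 : 1 ≤ δ) (n : ℤ)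
    (i : Fin (d + 1)) :
    ∑ v ∈ (boundedSimplex d s m).filter (fun v => v i = m),
        supportWeight n (pointSupport v).card = d * n + d.choose 2 * (δ - 1) := by
  have h := sum_supportWeight ((boundedSimplex d s m).filter fun v => v i = m) n (fun _ => 1)
  simp only [one_mul, mul_one] at h
  have hB : ∀ c, ∀ v ∈ (boundedSimplex d s m).filter (fun v => v i = m),
      (pointSupport v).card = c →
      pointSupport v ∈ (Finset.powersetCard c Finset.univ).filter fun S => i ∈ S := by
    rintro c v hv rfl
    simp only [Finset.mem_filter] at hv
    simp only [Finset.mem_filter, Finset.mem_powersetCard, Finset.subset_univ, true_and,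
      mem_pointSupport]
    omega
  have h𝒮 : ∀ c, ∀ S ∈ (Finset.powersetCard c Finset.univ).filter
      (fun S : Finset (Fin (d + 1)) => i ∈ S), S.card = c := fun c S hS => by
    simp only [Finset.mem_filter, Finset.mem_powersetCard] at hS
    exact hS.1.2
  -- A pair containing `i` carries only the point with coordinates `m` and `δ`. In a triple
  -- containing `i`, the other two coordinates are positive with sum `δ`, which leaves `δ - 1`
  -- points.
  rw [h, card_filter_card_pointSupport (N := 1) _ (hB 2) (h𝒮 2),
    card_filter_card_pointSupport (N := δ - 1) _ (hB 3) (h𝒮 3), card_filter_mem_powersetCard,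
    card_filter_mem_powersetCard, Fintype.card_fin]
  · push_cast [Nat.cast_sub hδ1]
    simp
  · intro S hS
    simp only [Finset.mem_filter, Finset.mem_powersetCard, Finset.subset_univ, true_and] at hS
    obtain ⟨j, k, hjk, hS'⟩ := Finset.card_eq_two.1
      (show (S.erase i).card = 2 by rw [Finset.card_erase_of_mem hS.2, hS.1])
    have hj : j ∈ S.erase i := by simp [hS']
    have hk : k ∈ S.erase i := by simp [hS']
    obtain rfl : S = {i, j, k} := by rw [← Finset.insert_erase hS.2, hS']
    have hij := (Finset.ne_of_mem_erase hj).symm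
    have hik := (Finset.ne_of_mem_erase hk).symm
    have hmem : ∀ v, v ∈ ((boundedSimplex d s m).filter fun v => v i = m).filter
        (fun v => pointSupport v = {i, j, k}) ↔ _ ∧ v i = m := fun v => by
      rw [Finset.mem_filter, Finset.mem_filter, and_right_comm,
        mem_boundedSimplex_triple hij hik hjk]
    rw [← Finset.card_range (δ - 1)]
    refine Finset.card_bij (fun v _ => v j - 1) (fun v hv => ?_) (fun v hv w hw h => ?_)
      (fun a ha => ?_)
    · have := (hmem v).1 hv
      rw [Finset.mem_range]
      omega
    · obtain ⟨⟨h₁, h₂, h₃, h₄, h₅, h₆, h₇, h₈⟩, h₉⟩ := (hmem v).1 hv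
      obtain ⟨⟨g₁, g₂, g₃, g₄, g₅, g₆, g₇, g₈⟩, g₉⟩ := (hmem w).1 hw
      rw [h₈, g₈, show v i = w i by omega, show v j = w j by omega, show v k = w k by omega]
    · rw [Finset.mem_range] at ha
      refine ⟨triplePoint i j k m (a + 1) (δ - 1 - a), (hmem _).2 ?_, ?_⟩
      · have h₁ : triplePoint i j k m (a + 1) (δ - 1 - a) i = m := by simp [triplePoint]
        have h₂ : triplePoint i j k m (a + 1) (δ - 1 - a) j = a + 1 := by
          simp [triplePoint, hij.symm]
        have h₃ : triplePoint i j k m (a + 1) (δ - 1 - a) k = δ - 1 - a := by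
          simp [triplePoint, hik.symm, hjk.symm]
        rw [h₁, h₂, h₃]
        refine ⟨⟨?_, ?_, ?_, ?_, ?_, ?_, ?_, rfl⟩, rfl⟩ <;> omega
      · simp [triplePoint, hij.symm]
  · intro S hS
    simp only [Finset.mem_filter, Finset.mem_powersetCard, Finset.subset_univ, true_and] at hS
    obtain ⟨j, hS'⟩ := Finset.card_eq_one.1
      (show (S.erase i).card = 1 by rw [Finset.card_erase_of_mem hS.2, hS.1])
    have hj : j ∈ S.erase i := by simp [hS']
    obtain rfl : S = {i, j} := by rw [← Finset.insert_erase hS.2, hS']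
    have hij := (Finset.ne_of_mem_erase hj).symm
    rw [Finset.card_eq_one]
    refine ⟨pairPoint i j m δ, Finset.ext fun v => ?_⟩
    rw [Finset.mem_filter, Finset.mem_filter, and_right_comm, mem_boundedSimplex_pair hij,
      Finset.mem_singleton]
    constructor
    · rintro ⟨⟨h₁, h₂, h₃, h₄, h₅, h₆⟩, h₇⟩
      rw [h₆, h₇, show v j = δ by omega]
    · rintro rfl
      have h₁ : pairPoint i j m δ i = m := by simp [pairPoint]
      have h₂ : pairPoint i j m δ j = δ := by simp [pairPoint, hij.symm]
      rw [h₁, h₂]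
      refine ⟨⟨?_, ?_, ?_, ?_, ?_, rfl⟩, rfl⟩ <;> omega

end Counting

/-! ### Edges as pairs of a point and a direction -/

section SimplexArcs

variable {d s m δ : ℕ}

/-- The end point of the edge at the point `P` of the simplex of size `s` in direction `l`. -/
def arcTarget (s m : ℕ) (P : Fin (d + 1) → ℕ) (l : Fin (d + 1)) : Fin (d + 1) → ℕ :=
  if P l = m then corner d s l else P + Pi.single l 1

theorem sum_corner (i : Fin (d + 1)) : ∑ j, corner d s i j = s := by
  simp [corner]

theorem sum_add_single (P : Fin (d + 1) → ℕ) (l : Fin (d + 1)) :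
    ∑ j, (P + Pi.single l 1 : Fin (d + 1) → ℕ) j = ∑ j, P j + 1 := by
  simp [Finset.sum_add_distrib]

theorem corner_notMem_boundedSimplex {N : ℕ} (hm : m < s) (i : Fin (d + 1)) :
    corner d s i ∉ boundedSimplex d N m := fun h => by
  have := (mem_boundedSimplex.1 h).2 i
  simp only [corner, Pi.single_eq_same] at this
  omega

theorem corner_injective (hs : 0 < s) : Function.Injective (corner d s) := fun i j h => by
  by_contra hij
  have := congrFun h i
  simp only [corner, Pi.single_eq_same, Pi.single_eq_of_ne hij] at this
  omega

theorem add_single_mem_boundedSimplex {P : Fin (d + 1) → ℕ} (hP : P ∈ boundedSimplex d s m)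
    {l : Fin (d + 1)} (hl : P l ≠ m) : P + Pi.single l 1 ∈ boundedSimplex d (s + 1) m := by
  obtain ⟨hsum, hm⟩ := mem_boundedSimplex.1 hP
  refine mem_boundedSimplex.2 ⟨by rw [sum_add_single, hsum], fun i => ?_⟩
  have := hm i
  by_cases h : i = l
  · subst h
    simp only [Pi.add_apply, Pi.single_eq_same]
    omega
  · simpa [Pi.single_eq_of_ne h] using this

/-- If `P l = m`, then both sides fail: a corner has a coordinate above `m`, and so has `P + e_l`.
-/
theorem arcTarget_eq_iff {P Q : Fin (d + 1) → ℕ} (hm : m < s)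
    (hQ : Q ∈ boundedSimplex d (s + 1) m) (l : Fin (d + 1)) :
    arcTarget s m P l = Q ↔ P + Pi.single l 1 = Q := by
  rw [arcTarget]
  split_ifs with h
  · refine iff_of_false ?_ ?_
    · rintro rfl
      exact corner_notMem_boundedSimplex hm l hQ
    · rintro rfl
      have := (mem_boundedSimplex.1 hQ).2 l
      simp only [Pi.add_apply, Pi.single_eq_same] at this
      omega
  · rfl

theorem arcTarget_eq_corner_iff {P : Fin (d + 1) → ℕ} (hs : 0 < s)
    (hP : P ∈ boundedSimplex d s m) {l i : Fin (d + 1)} :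
    arcTarget s m P l = corner d s i ↔ l = i ∧ P l = m := by
  rw [arcTarget]
  split_ifs with h
  · simp [h, (corner_injective hs).eq_iff]
  · refine iff_of_false (fun he => ?_) (by simp [h])
    have := sum_add_single P l
    rw [he, sum_corner, (mem_boundedSimplex.1 hP).1] at this
    omega

theorem arcTarget_notMem {P : Fin (d + 1) → ℕ} (hm : m < s) (hP : P ∈ boundedSimplex d s m)
    (l : Fin (d + 1)) : arcTarget s m P l ∉ boundedSimplex d s m := by
  rw [arcTarget]
  split_ifs with h
  · exact corner_notMem_boundedSimplex hm l
  · intro h'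
    have := sum_add_single P l
    rw [(mem_boundedSimplex.1 h').1, (mem_boundedSimplex.1 hP).1] at this
    omega

theorem arcTarget_mem {P : Fin (d + 1) → ℕ} (hP : P ∈ boundedSimplex d s m)
    (l : Fin (d + 1)) :
    arcTarget s m P l ∈ boundedSimplex d (s + 1) m ∨ ∃ i, arcTarget s m P l = corner d s i := by
  rw [arcTarget]
  split_ifs with h
  · exact Or.inr ⟨l, rfl⟩
  · exact Or.inl (add_single_mem_boundedSimplex hP h)

theorem arcTarget_injective {P : Fin (d + 1) → ℕ} (hm : m < s) (hP : P ∈ boundedSimplex d s m) :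
    Function.Injective (arcTarget s m P) := fun l l' h => by
  rcases arcTarget_mem hP l' with h' | ⟨i, h'⟩
  · have h₁ := (arcTarget_eq_iff hm h' l).1 h
    have h₂ := (arcTarget_eq_iff hm h' l').1 rfl
    have h₃ := congrFun (add_left_cancel (h₁.trans h₂.symm)) l
    by_contra hl
    simp [Pi.single_eq_of_ne hl] at h₃
  · have h₁ := (arcTarget_eq_corner_iff (by omega) hP).1 h'
    have h₂ := (arcTarget_eq_corner_iff (by omega) hP).1 (h.trans h')
    rw [h₁.1, h₂.1]

/-- The sum over the arcs that end at a point of the simplex of size `s + 1`. -/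
theorem sum_arcTarget_eq_of_mem {Q : Fin (d + 1) → ℕ} (hm : m < s)
    (hQ : Q ∈ boundedSimplex d (s + 1) m) (F : (Fin (d + 1) → ℕ) → Fin (d + 1) → ℝ) :
    ∑ P ∈ boundedSimplex d s m, ∑ l, (if arcTarget s m P l = Q then F P l else 0) =
      ∑ l ∈ pointSupport Q, F (Q - Pi.single l 1) l := by
  rw [Finset.sum_comm]
  symm
  rw [pointSupport, Finset.sum_filter]
  refine Finset.sum_congr rfl fun l _ => ?_
  simp only [arcTarget_eq_iff hm hQ]
  split_ifs with hl
  · have hadd : Q - Pi.single l 1 + Pi.single l 1 = Q := by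
      refine tsub_add_cancel_of_le fun i => ?_
      by_cases h : i = l
      · subst h
        simp only [Pi.single_eq_same]
        omega
      · simp [Pi.single_eq_of_ne h]
    rw [Finset.sum_eq_single (Q - Pi.single l 1), if_pos hadd]
    · intro P _ hne
      refine if_neg fun h => hne ?_
      rw [← h, add_tsub_cancel_right]
    · intro h
      refine absurd (mem_boundedSimplex.2 ⟨?_, fun i => ?_⟩) h
      · have := sum_add_single (Q - Pi.single l 1) l
        rw [hadd, (mem_boundedSimplex.1 hQ).1] at this
        omega
      · exact le_trans tsub_le_self ((mem_boundedSimplex.1 hQ).2 i)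
  · refine (Finset.sum_eq_zero fun P _ => if_neg ?_).symm
    rintro rfl
    simp at hl

/-- The sum over the arcs that end at a corner. -/
theorem sum_arcTarget_eq_corner (hs : 0 < s) (i : Fin (d + 1))
    (F : (Fin (d + 1) → ℕ) → Fin (d + 1) → ℝ) :
    ∑ P ∈ boundedSimplex d s m, ∑ l, (if arcTarget s m P l = corner d s i then F P l else 0) =
      ∑ P ∈ (boundedSimplex d s m).filter (fun P => P i = m), F P i := by
  rw [Finset.sum_filter]
  refine Finset.sum_congr rfl fun P hP => ?_
  simp only [arcTarget_eq_corner_iff hs hP, ite_and]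
  simp

/-- The sum over all arcs, ordered by their end points. -/
theorem sum_arcs (hm : m < s) (F : (Fin (d + 1) → ℕ) → Fin (d + 1) → ℝ) :
    ∑ P ∈ boundedSimplex d s m, ∑ l, F P l =
      ∑ Q ∈ boundedSimplex d (s + 1) m, ∑ l ∈ pointSupport Q, F (Q - Pi.single l 1) l +
        ∑ i, ∑ P ∈ (boundedSimplex d s m).filter (fun P => P i = m), F P i := by
  have hs : 0 < s := by omega
  rw [Finset.sum_congr rfl fun Q hQ => (sum_arcTarget_eq_of_mem hm hQ F).symm,
    Finset.sum_congr rfl fun i _ => (sum_arcTarget_eq_corner (m := m) hs i F).symm,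
    Finset.sum_comm (s := boundedSimplex d (s + 1) m), Finset.sum_comm (s := Finset.univ),
    ← Finset.sum_add_distrib]
  refine Finset.sum_congr rfl fun P hP => ?_
  rw [Finset.sum_comm (s := boundedSimplex d (s + 1) m),
    Finset.sum_comm (s := Finset.univ)
      (f := fun i l => if arcTarget s m P l = corner d s i then F P l else 0),
    ← Finset.sum_add_distrib]
  refine Finset.sum_congr rfl fun l _ => ?_
  rcases arcTarget_mem hP l with h | ⟨i, h⟩
  · rw [Finset.sum_ite_eq, if_pos h, Finset.sum_eq_zero, add_zero]
    intro i _
    refine if_neg fun h' => corner_notMem_boundedSimplex hm i (h' ▸ h)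
  · simp only [h, (corner_injective hs).eq_iff]
    rw [Finset.sum_ite_eq, if_neg (corner_notMem_boundedSimplex hm i)]
    simp

theorem pointSupport_add_single (P : Fin (d + 1) → ℕ) (l : Fin (d + 1)) :
    pointSupport (P + Pi.single l 1) = insert l (pointSupport P) := by
  ext i
  by_cases h : i = l
  · subst h
    simp
  · simp [h]

theorem level_eq (v : Fin (d + 1) → ℕ) : level v = (pointSupport v).card - 1 := rfl

/-- The level of an edge is determined by the support of its end in the simplex of size `s` and
its direction. -/
theorem max_level_arcTarget (hm : 0 < m) (hms : m < s) (P : Fin (d + 1) → ℕ) (l : Fin (d + 1)) :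
    max (level P) (level (arcTarget s m P l)) = (insert l (pointSupport P)).card - 1 := by
  rw [level_eq, level_eq, arcTarget]
  split_ifs with h
  · have hl : l ∈ pointSupport P := by
      rw [mem_pointSupport]
      omega
    have : pointSupport (corner d s l) = {l} := by
      rw [pointSupport_eq_iff]
      intro i
      by_cases h : i = l
      · subst h
        simp only [corner, Pi.single_eq_same, Finset.mem_singleton, iff_true]
        omega
      · simp [corner, h]
    rw [this, Finset.insert_eq_of_mem hl]
    simp
  · rw [pointSupport_add_single]
    exact max_eq_right (Nat.sub_le_sub_right (Finset.card_le_card (Finset.subset_insert _ _)) 1)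

/-- A single coordinate, being at most `m < N`, cannot carry the whole sum. Hence level `0` occurs
only at the corners. -/
theorem two_le_card_pointSupport {N : ℕ} (hm : m < N) {P : Fin (d + 1) → ℕ}
    (hP : P ∈ boundedSimplex d N m) : 2 ≤ (pointSupport P).card := by
  obtain ⟨hsum, hle⟩ := mem_boundedSimplex.1 hP
  rw [← sum_pointSupport] at hsum
  by_contra hc
  interval_cases h : (pointSupport P).card
  · rw [Finset.card_eq_zero] at h
    simp [h] at hsum
    omega
  · obtain ⟨i, hi⟩ := Finset.card_eq_one.1 h
    have := hle i
    simp [hi] at hsum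
    omega

theorem l1Dist_add_single (P : Fin (d + 1) → ℕ) (l : Fin (d + 1)) :
    l1Dist P (P + Pi.single l 1) = 1 := by
  rw [l1Dist, Finset.sum_eq_single l]
  · simp
  · intro i _ h
    simp [Pi.single_eq_of_ne h]
  · simp

/-- Coordinate `l` is short by `δ`, and the other coordinates of `P` have sum `δ`. -/
theorem l1Dist_corner {P : Fin (d + 1) → ℕ} (hm : m + δ = s) (hP : P ∈ boundedSimplex d s m)
    {l : Fin (d + 1)} (hl : P l = m) : l1Dist P (corner d s l) = 2 * δ := by
  have hsum := (mem_boundedSimplex.1 hP).1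
  rw [l1Dist, ← Finset.add_sum_erase _ _ (Finset.mem_univ l)]
  rw [← Finset.add_sum_erase _ _ (Finset.mem_univ l)] at hsum
  have h : ∀ i ∈ Finset.univ.erase l, |(P i : ℤ) - (corner d s l i : ℤ)| = P i := fun i hi => by
    simp [corner, Pi.single_eq_of_ne (Finset.ne_of_mem_erase hi)]
  rw [Finset.sum_congr rfl h, ← Nat.cast_sum, hl]
  rw [corner, Pi.single_eq_same, abs_of_nonpos (by omega)]
  omega

theorem eq_add_single_of_l1Dist_eq_one {v w : Fin (d + 1) → ℕ} (h : l1Dist v w = 1) :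
    ∃ l, w = v + Pi.single l 1 ∨ v = w + Pi.single l 1 := by
  obtain ⟨l, hl⟩ : ∃ l, v l ≠ w l := by
    by_contra! hall
    simp [l1Dist, hall] at h
  rw [l1Dist, ← Finset.add_sum_erase _ _ (Finset.mem_univ l)] at h
  have hl1 : 1 ≤ |(v l : ℤ) - w l| := Int.one_le_abs (by omega)
  have hnn : ∀ i ∈ Finset.univ.erase l, 0 ≤ |(v i : ℤ) - w i| := fun i _ => abs_nonneg _
  have h0 : ∑ i ∈ Finset.univ.erase l, |(v i : ℤ) - w i| = 0 :=
    le_antisymm (by omega) (Finset.sum_nonneg hnn)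
  have heq : ∀ i, i ≠ l → v i = w i := fun i hi => by
    have := (Finset.sum_eq_zero_iff_of_nonneg hnn).1 h0 i (by simp [hi])
    rw [abs_eq_zero] at this
    omega
  have hl2 : |(v l : ℤ) - w l| = 1 := by omega
  have key : ∀ a b : Fin (d + 1) → ℕ, (∀ i, i ≠ l → a i = b i) → b l = a l + 1 →
      b = a + Pi.single l 1 := fun a b hab hbl => funext fun i => by
    by_cases hi : i = l
    · subst hi
      simp [hbl]
    · simp [Pi.single_eq_of_ne hi, hab i hi]
  refine ⟨l, ?_⟩
  rcases abs_eq (zero_le_one' ℤ) |>.1 hl2 with h | h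
  · exact Or.inr (key w v (fun i hi => (heq i hi).symm) (by omega))
  · exact Or.inl (key v w heq (by omega))

end SimplexArcs

/-! ### The flow on the simplex graph, its feasibility and its cost -/

section SimplexFlow

variable {d s m δ : ℕ}

theorem mem_innerVerts_iff (hm : m + δ = s) {v : Fin (d + 1) → ℕ} :
    v ∈ innerVerts d s δ ↔ v ∈ boundedSimplex d s m ∨ v ∈ boundedSimplex d (s + 1) m := by
  have h : ∀ i, v i + δ ≤ s ↔ v i ≤ m := fun i => by omega
  simp [innerVerts, boundedSimplex, h, or_and_right]

theorem mem_vertices_iff (hm : m + δ = s) {v : Fin (d + 1) → ℕ} :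
    v ∈ innerVerts d s δ ∪ corners d s ↔ v ∈ boundedSimplex d s m ∨
      v ∈ boundedSimplex d (s + 1) m ∨ ∃ i, v = corner d s i := by
  rw [Finset.mem_union, mem_innerVerts_iff hm, or_assoc]
  simp [corners, eq_comm]

theorem arcTarget_mem_vertices (hm : m + δ = s) {P : Fin (d + 1) → ℕ}
    (hP : P ∈ boundedSimplex d s m) (l : Fin (d + 1)) :
    arcTarget s m P l ∈ innerVerts d s δ ∪ corners d s :=
  (mem_vertices_iff hm).2 (Or.inr (arcTarget_mem hP l))

/-- The edges of the simplified simplex graph, oriented away from the simplex of size `s`. -/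
def simplexArcs (hm : m + δ = s) (hδ : 1 ≤ δ) :
    ArcSystem (simplexGraph d s δ) (boundedSimplex d s m × Fin (d + 1)) where
  src a := ⟨a.1.1, (mem_vertices_iff hm).2 (Or.inl a.1.2)⟩
  tgt a := ⟨arcTarget s m a.1.1 a.2, arcTarget_mem_vertices hm a.1.2 a.2⟩
  adj := by
    rintro ⟨⟨P, hP⟩, l⟩
    rw [simplexGraph, SimpleGraph.fromRel_adj]
    refine ⟨fun h => ?_, ?_⟩
    · exact arcTarget_notMem (by omega) hP l ((Subtype.mk_eq_mk.1 h) ▸ hP)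
    · have hPi := (mem_innerVerts_iff hm).2 (Or.inl hP)
      by_cases hl : P l = m
      · refine Or.inr (Or.inr ⟨l, by simp [arcTarget, hl], ?_, hPi, by simp [hl, hm]⟩)
        exact (Finset.mem_filter.1 hP).1
      · refine Or.inl (Or.inl ⟨hPi, ?_, ?_⟩)
        · simp only [arcTarget, if_neg hl]
          exact (mem_innerVerts_iff hm).2 (Or.inr (add_single_mem_boundedSimplex hP hl))
        · simp only [arcTarget, if_neg hl]
          exact l1Dist_add_single P l
  inj := by
    rintro ⟨⟨P, hP⟩, l⟩ ⟨⟨P', hP'⟩, l'⟩ h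
    rcases Sym2.eq_iff.1 h with ⟨h₁, h₂⟩ | ⟨h₁, -⟩
    · obtain rfl : P = P' := congrArg Subtype.val h₁
      obtain rfl : l = l' := arcTarget_injective (by omega) hP (congrArg Subtype.val h₂)
      rfl
    · have h₁' : P = arcTarget s m P' l' := congrArg Subtype.val h₁
      exact absurd (h₁' ▸ hP) (arcTarget_notMem (by omega) hP' l')
  surj := by
    have key : ∀ v w : SimplexVertex d s δ, v.1 ∈ boundedSimplex d s m →
        (∃ l, arcTarget s m v.1 l = w.1) → ∃ a : boundedSimplex d s m × Fin (d + 1),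
        (s(⟨a.1.1, (mem_vertices_iff hm).2 (Or.inl a.1.2)⟩,
          ⟨arcTarget s m a.1.1 a.2, arcTarget_mem_vertices hm a.1.2 a.2⟩) :
          Sym2 (SimplexVertex d s δ)) = s(v, w) := by
      rintro ⟨v, hv⟩ ⟨w, hw⟩ hvB ⟨l, hl⟩
      refine ⟨(⟨v, hvB⟩, l), ?_⟩
      rw [Sym2.eq_iff]
      exact Or.inl ⟨rfl, Subtype.ext hl⟩
    have step : ∀ v w : Fin (d + 1) → ℕ, v ∈ innerVerts d s δ → w ∈ innerVerts d s δ →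
        (∃ l, w = v + Pi.single l 1) →
        v ∈ boundedSimplex d s m ∧ ∃ l, arcTarget s m v l = w := by
      rintro v w hv hw ⟨l, hl⟩
      have hsum := sum_add_single v l
      rw [← hl] at hsum
      rw [mem_innerVerts_iff hm] at hv hw
      -- The coordinate sums differ by one and both lie in `{s, s + 1}`, which determines the
      -- simplex of each end.
      have hvB : v ∈ boundedSimplex d s m := hv.resolve_right fun h => by
        rw [(mem_boundedSimplex.1 h).1] at hsum
        rcases hw with h' | h' <;> rw [(mem_boundedSimplex.1 h').1] at hsum <;> omega
      have hwB : w ∈ boundedSimplex d (s + 1) m := hw.resolve_left fun h => by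
        rw [(mem_boundedSimplex.1 h).1, (mem_boundedSimplex.1 hvB).1] at hsum
        omega
      exact ⟨hvB, l, (arcTarget_eq_iff (by omega) hwB l).2 hl.symm⟩
    have rel : ∀ v w : SimplexVertex d s δ,
        ((v.1 ∈ innerVerts d s δ ∧ w.1 ∈ innerVerts d s δ ∧ l1Dist v.1 w.1 = 1) ∨
          (∃ i, v.1 = corner d s i ∧ w.1 ∈ discreteSimplex d s ∧ w.1 ∈ innerVerts d s δ ∧
            w.1 i + δ = s)) → ∃ a : boundedSimplex d s m × Fin (d + 1),
        (s(⟨a.1.1, (mem_vertices_iff hm).2 (Or.inl a.1.2)⟩,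
          ⟨arcTarget s m a.1.1 a.2, arcTarget_mem_vertices hm a.1.2 a.2⟩) :
          Sym2 (SimplexVertex d s δ)) = s(v, w) := by
      rintro v w (⟨hv, hw, hvw⟩ | ⟨i, hv, hw, hwi, hi⟩)
      · obtain ⟨l, hl | hl⟩ := eq_add_single_of_l1Dist_eq_one hvw
        · obtain ⟨h₁, h₂⟩ := step _ _ hv hw ⟨l, hl⟩
          exact key v w h₁ h₂
        · obtain ⟨h₁, h₂⟩ := step _ _ hw hv ⟨l, hl⟩
          rw [Sym2.eq_swap (a := v)]
          exact key w v h₁ h₂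
      · rw [Sym2.eq_swap (a := v)]
        refine key w v (Finset.mem_filter.2 ⟨hw, fun j => ?_⟩) ⟨i, ?_⟩
        · have := (Finset.mem_filter.1 hwi).2 j
          omega
        · rw [arcTarget, if_pos (by omega), hv]
    intro v w hvw
    rw [simplexGraph, SimpleGraph.fromRel_adj] at hvw
    rcases hvw.2 with h | h
    · exact rel v w h
    · rw [Sym2.eq_swap (a := v)]
      exact rel w v h

theorem sum_simplexArcs (F : (Fin (d + 1) → ℕ) → Fin (d + 1) → ℝ) :
    ∑ a : boundedSimplex d s m × Fin (d + 1), F a.1.1 a.2 =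
      ∑ P ∈ boundedSimplex d s m, ∑ l, F P l := by
  rw [Fintype.sum_prod_type, ← Finset.sum_coe_sort (boundedSimplex d s m)]

/-- The flow for the root `r`, up to scaling, from the point `P` in direction `l`. -/
def pointFlow (s : ℕ) (n : ℤ) (r : Fin (d + 1)) (P : Fin (d + 1) → ℕ) (l : Fin (d + 1)) : ℤ :=
  arcFlow n s r (insert l (pointSupport P)) (fun i => (P i : ℤ)) l

open Classical in
/-- The vertex balances, up to scaling away from the corners. -/
def pointBalance (s m : ℕ) (β : ℝ) (v : Fin (d + 1) → ℕ) : ℝ :=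
  if ∃ i, v = corner d s i then -1
  else if v ∈ boundedSimplex d s m then
    β * ((if (pointSupport v).card = 2 then (d : ℤ) - 1
      else if (pointSupport v).card = 3 then 1 else 0 : ℤ) : ℝ)
  else -(β * ((if (pointSupport v).card = 3 then 1 else 0 : ℤ) : ℝ))

variable {n : ℤ}

theorem abs_pointFlow_le (hn : n = 2 * m - s + 1) (hn1 : 1 ≤ n) {P : Fin (d + 1) → ℕ}
    (hP : P ∈ boundedSimplex d s m) (r l : Fin (d + 1)) :
    |pointFlow s n r P l| ≤ supportWeight n (insert l (pointSupport P)).card := by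
  obtain ⟨hsum, hm⟩ := mem_boundedSimplex.1 hP
  refine abs_arcFlow_le (m := m) hn hn1 ?_ (Finset.mem_insert_self _ _)
    (fun l => by exact_mod_cast hm l) (by exact_mod_cast hsum)
  intro k hk hkS
  by_contra h
  exact hkS (Finset.mem_insert_of_mem (mem_pointSupport.2 (by exact_mod_cast h)))

theorem sum_pointFlow (hms : m < s) (hd : d = 2 ∨ ((s : ℤ) = 3 * n + 1 ∧ (m : ℤ) = 2 * n))
    {P : Fin (d + 1) → ℕ} (hP : P ∈ boundedSimplex d s m) (r : Fin (d + 1)) :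
    ∑ l, pointFlow s n r P l = if (pointSupport P).card = 2 then (d : ℤ) - 1
      else if (pointSupport P).card = 3 then 1 else 0 := by
  obtain ⟨hsum, hm⟩ := mem_boundedSimplex.1 hP
  have := sum_arcFlow_insert (n := n) (s := s) (r := r) (S := pointSupport P) (m := m)
    (P := fun i => (P i : ℤ)) (by simpa using hd) (two_le_card_pointSupport hms hP)
    (fun l => by positivity) (by simp) (fun l => by exact_mod_cast hm l) (by exact_mod_cast hsum)
  simp only [pointFlow, this, Fintype.card_fin]
  push_cast
  congr 1
  ring

theorem sum_pointFlow_sub_single (hd : d = 2 ∨ ((s : ℤ) = 3 * n + 1 ∧ (m : ℤ) = 2 * n))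
    {Q : Fin (d + 1) → ℕ} (hQ : Q ∈ boundedSimplex d (s + 1) m) (r : Fin (d + 1)) :
    ∑ l ∈ pointSupport Q, pointFlow s n r (Q - Pi.single l 1) l =
      if (pointSupport Q).card = 3 then 1 else 0 := by
  have hsum := (mem_boundedSimplex.1 hQ).1
  rw [← sum_pointSupport] at hsum
  rw [← sum_arcFlow_sub_single (n := n) (s := s) (r := r) (S := pointSupport Q)
    (Q := fun i => (Q i : ℤ)) _ (by exact_mod_cast hsum)]
  · refine Finset.sum_congr rfl fun l hl => ?_
    rw [mem_pointSupport] at hl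
    have hle : Pi.single l 1 ≤ Q := fun i => by
      by_cases h : i = l
      · subst h
        simp only [Pi.single_eq_same]
        omega
      · simp [Pi.single_eq_of_ne h]
    rw [pointFlow, ← pointSupport_add_single, tsub_add_cancel_of_le hle]
    congr 1
    funext i
    rw [Pi.sub_apply, Pi.sub_apply, Nat.cast_sub (hle i)]
    by_cases h : i = l
    · subst h
      simp
    · simp [Pi.single_eq_of_ne h]
  · intro hr h3
    rcases hd with rfl | h
    · have := Finset.card_le_univ (insert r (pointSupport Q))
      rw [Finset.card_insert_of_notMem hr, h3, Fintype.card_fin] at this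
      omega
    · exact h.1

/-- Every arc at a corner is saturated, and its direction is reversed exactly at the root. After
scaling, the net outflow is `-1` at the other corners and `1` at the root. -/
theorem sum_pointFlow_corner (hm : m + δ = s) (hδ : δ ≤ m) (hδ1 : 1 ≤ δ)
    (hn : n = 2 * m - s + 1) (hn1 : 1 ≤ n)
    (hd : d = 2 ∨ ((s : ℤ) = 3 * n + 1 ∧ (m : ℤ) = 2 * n)) (r i : Fin (d + 1)) :
    ∑ P ∈ (boundedSimplex d s m).filter (fun P => P i = m), pointFlow s n r P i =
      (if i = r then -1 else 1) * (d * n + d.choose 2 * (δ - 1)) := by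
  rw [← sum_lower_supportWeight hm hδ hδ1 n i, Finset.mul_sum]
  refine Finset.sum_congr rfl fun P hP => ?_
  obtain ⟨hPB, hi⟩ := Finset.mem_filter.1 hP
  obtain ⟨hsum, hle⟩ := mem_boundedSimplex.1 hPB
  have hiS : i ∈ pointSupport P := mem_pointSupport.2 (by omega)
  rw [pointFlow, Finset.insert_eq_of_mem hiS]
  split_ifs with hir
  · rw [arcFlow, if_pos hir, neg_one_mul]
  · rw [one_mul]
    exact arcFlow_of_eq_max (m := m) (by simpa using hd) hn hn1 (fun l => by positivity)
      (by simp) (fun l => by exact_mod_cast hle l) (by exact_mod_cast hsum) (by exact_mod_cast hi)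
      hir

/-- The balances of the scaled flow for the root `r`. -/
theorem sum_pointFlow_sub_sum_pointFlow (hm : m + δ = s) (hδ : δ ≤ m) (hδ1 : 1 ≤ δ)
    (hn : n = 2 * m - s + 1) (hn1 : 1 ≤ n)
    (hd : d = 2 ∨ ((s : ℤ) = 3 * n + 1 ∧ (m : ℤ) = 2 * n)) {β : ℝ}
    (hβ : β * ((d * n + d.choose 2 * (δ - 1) : ℤ) : ℝ) = 1) (r : Fin (d + 1))
    {v : Fin (d + 1) → ℕ} (hv : v ∈ innerVerts d s δ ∪ corners d s) :
    ∑ P ∈ boundedSimplex d s m, ∑ l, (if P = v then β * (pointFlow s n r P l : ℝ) else 0) -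
      ∑ P ∈ boundedSimplex d s m, ∑ l,
        (if arcTarget s m P l = v then β * (pointFlow s n r P l : ℝ) else 0) =
      pointBalance s m β v + if v = corner d s r then 2 else 0 := by
  have hms : m < s := by omega
  have hsrc : v ∉ boundedSimplex d s m → ∑ P ∈ boundedSimplex d s m, ∑ l,
      (if P = v then β * (pointFlow s n r P l : ℝ) else 0) = 0 := fun h =>
    Finset.sum_eq_zero fun P hP => Finset.sum_eq_zero fun l _ =>
      if_neg fun h' : P = v => h (h' ▸ hP)
  have hcor : ∀ N, v ∈ boundedSimplex d N m → ¬∃ i, v = corner d s i := by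
    rintro N h ⟨i, rfl⟩
    exact corner_notMem_boundedSimplex hms i h
  rcases (mem_vertices_iff hm).1 hv with h | h | ⟨i, rfl⟩
  · have htgt : ∑ P ∈ boundedSimplex d s m, ∑ l,
        (if arcTarget s m P l = v then β * (pointFlow s n r P l : ℝ) else 0) = 0 :=
      Finset.sum_eq_zero fun P hP => Finset.sum_eq_zero fun l _ =>
        if_neg fun h' : arcTarget s m P l = v => arcTarget_notMem hms hP l (h' ▸ h)
    rw [htgt, sub_zero, Finset.sum_eq_single v, pointBalance, if_neg (hcor _ h), if_pos h,
      if_neg fun h' => hcor _ h ⟨r, h'⟩, add_zero, ← sum_pointFlow hms hd h r, Int.cast_sum,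
      Finset.mul_sum]
    · simp
    · intro P _ hne
      simp [hne]
    · exact fun h' => absurd h h'
  · have h' : v ∉ boundedSimplex d s m := fun h' => by
      have h₁ := (mem_boundedSimplex.1 h).1
      have h₂ := (mem_boundedSimplex.1 h').1
      omega
    rw [hsrc h', sum_arcTarget_eq_of_mem hms h, pointBalance, if_neg (hcor _ h), if_neg h',
      if_neg fun h' => hcor _ h ⟨r, h'⟩, ← sum_pointFlow_sub_single hd h r, Int.cast_sum,
      Finset.mul_sum]
    ring
  · rw [hsrc (corner_notMem_boundedSimplex hms i), sum_arcTarget_eq_corner (by omega),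
      ← Finset.mul_sum, ← Int.cast_sum, sum_pointFlow_corner hm hδ hδ1 hn hn1 hd,
      pointBalance, if_pos (show ∃ j, corner d s i = corner d s j from ⟨i, rfl⟩), Int.cast_mul,
      mul_left_comm, hβ]
    simp only [(corner_injective (d := d) (show 0 < s by omega)).eq_iff]
    split_ifs <;> norm_num

/-- The usages of the edges. -/
def simplexUsage (n : ℤ) (β : ℝ) (e : Sym2 (SimplexVertex d s δ)) : ℝ :=
  β * supportWeight n (edgeLevel e + 1)

theorem edgeLevel_simplexArcs (hm : m + δ = s) (hδ : δ ≤ m) (hδ1 : 1 ≤ δ)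
    (a : boundedSimplex d s m × Fin (d + 1)) :
    edgeLevel s((simplexArcs hm hδ1).src a, (simplexArcs hm hδ1).tgt a) + 1 =
      (insert a.2 (pointSupport a.1.1)).card := by
  have h := max_level_arcTarget (d := d) (s := s) (m := m) (by omega) (by omega) a.1.1 a.2
  have : 0 < (insert a.2 (pointSupport a.1.1)).card :=
    Finset.card_pos.2 (Finset.insert_nonempty _ _)
  change max (level a.1.1) (level (arcTarget s m a.1.1 a.2)) + 1 = _
  omega

theorem supportWeight_nonneg (hn1 : 1 ≤ n) (c : ℕ) : 0 ≤ supportWeight n c := by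
  rw [supportWeight]
  split_ifs <;> omega

/-- The usages are feasible for the flow form. -/
theorem exists_isMBFRSolution (hm : m + δ = s) (hδ : δ ≤ m) (hδ1 : 1 ≤ δ)
    (hn : n = 2 * m - s + 1) (hn1 : 1 ≤ n)
    (hd : d = 2 ∨ ((s : ℤ) = 3 * n + 1 ∧ (m : ℤ) = 2 * n)) {β : ℝ} (hβ0 : 0 ≤ β)
    (hβ : β * ((d * n + d.choose 2 * (δ - 1) : ℤ) : ℝ) = 1) :
    ∃ (b : SimplexVertex d s δ → ℝ)
      (f : SimplexVertex d s δ → SimplexVertex d s δ → SimplexVertex d s δ → ℝ),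
      (simplexInstance d s δ).IsMBFRSolution (simplexUsage n β) b f ∧
        ∀ r ∈ (simplexInstance d s δ).terminals, b r = -1 := by
  have hterm : ∀ r ∈ (simplexInstance d s δ).terminals, ∃ i, r.1 = corner d s i := fun r hr => by
    obtain ⟨i, -, hi⟩ := Finset.mem_image.1 (Finset.mem_filter.1 hr).2
    exact ⟨i, hi.symm⟩
  have hflow : ∀ r ∈ (simplexInstance d s δ).terminals,
      ∃ f, IsBidirectedBalanceFlow (simplexGraph d s δ) (simplexUsage n β)
        (fun v => pointBalance s m β v.1 + if v = r then 2 else 0) f := by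
    intro r hr
    obtain ⟨i, hi⟩ := hterm r hr
    refine ⟨_, (simplexArcs hm hδ1).isBidirectedBalanceFlow
      (γ := fun a => β * (pointFlow s n i a.1.1 a.2 : ℝ)) (fun a => ?_) fun v => ?_⟩
    · rw [simplexUsage, edgeLevel_simplexArcs hm hδ hδ1, abs_mul, abs_of_nonneg hβ0,
        ← Int.cast_abs]
      gcongr
      exact abs_pointFlow_le hn hn1 a.1.2 i a.2
    · have h := sum_pointFlow_sub_sum_pointFlow hm hδ hδ1 hn hn1 hd hβ i v.2
      rw [← sum_simplexArcs, ← sum_simplexArcs, ← hi] at h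
      simp only [Subtype.ext_iff]
      exact h
  choose! f hf using hflow
  refine ⟨fun v => pointBalance s m β v.1, f, ⟨fun e _ => ?_, fun r hr => ?_⟩, fun r hr => ?_⟩
  · exact mul_nonneg hβ0 (Int.cast_nonneg (supportWeight_nonneg hn1 _))
  · convert hf r hr
    rfl
  · exact if_pos (hterm r hr)

/-- The cost of the usages. -/
theorem totalCost_simplexUsage (hm : m + δ = s) (hδ : δ ≤ m) (hδ1 : 1 ≤ δ) {β : ℝ}
    (hβ : β * ((d * n + d.choose 2 * (δ - 1) : ℤ) : ℝ) = 1) :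
    (simplexInstance d s δ).totalCost (simplexUsage n β) = 2 * δ * (d + 1) +
      β / 2 * (4 * n * ((d + 1).choose 2 * (s - 2 * δ)) +
        3 * ((d + 1).choose 3 * (s * (s - 1) - 3 * δ * (δ - 1)))) := by
  have hms : m < s := by omega
  have hcost : (simplexInstance d s δ).totalCost (simplexUsage n β) =
      ∑ a : boundedSimplex d s m × Fin (d + 1),
        (l1Dist a.1.1 (arcTarget s m a.1.1 a.2) : ℝ) *
          (β * supportWeight n (insert a.2 (pointSupport a.1.1)).card) := by
    refine ((simplexArcs hm hδ1).sum_edgeFinset _).trans (Finset.sum_congr rfl fun a _ => ?_)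
    rw [simplexUsage, edgeLevel_simplexArcs hm hδ hδ1]
    rfl
  rw [hcost, sum_simplexArcs (fun P l => (l1Dist P (arcTarget s m P l) : ℝ) *
    -- Grouping arcs by their ends separates the two edge lengths. A point of the larger simplex
    -- receives one arc of length `1` from each direction in its support, all with the same usage;
    -- each corner receives total usage `1` over length `2 * δ`.
    (β * supportWeight n (insert l (pointSupport P)).card)), sum_arcs hms]
  have hupper : ∀ Q ∈ boundedSimplex d (s + 1) m, ∑ l ∈ pointSupport Q,
      (l1Dist (Q - Pi.single l 1) (arcTarget s m (Q - Pi.single l 1) l) : ℝ) *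
        (β * supportWeight n (insert l (pointSupport (Q - Pi.single l 1))).card) =
      β * (((pointSupport Q).card * supportWeight n (pointSupport Q).card : ℤ) : ℝ) := by
    intro Q hQ
    have h : ∀ l ∈ pointSupport Q,
        (l1Dist (Q - Pi.single l 1) (arcTarget s m (Q - Pi.single l 1) l) : ℝ) *
          (β * supportWeight n (insert l (pointSupport (Q - Pi.single l 1))).card) =
        β * supportWeight n (pointSupport Q).card := fun l hl => by
      rw [mem_pointSupport] at hl
      have hle : Pi.single l 1 ≤ Q := fun i => by
        by_cases h : i = l
        · subst h
          simp only [Pi.single_eq_same]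
          omega
        · simp [Pi.single_eq_of_ne h]
      have hadd := tsub_add_cancel_of_le hle
      have hdist := l1Dist_add_single (Q - Pi.single l 1) l
      rw [hadd] at hdist
      rw [(arcTarget_eq_iff hms hQ l).2 hadd, hdist, ← pointSupport_add_single, hadd]
      simp
    rw [Finset.sum_congr rfl h, Finset.sum_const]
    push_cast
    rw [nsmul_eq_mul]
    ring
  have hlower : ∀ i, ∑ P ∈ (boundedSimplex d s m).filter (fun P => P i = m),
      (l1Dist P (arcTarget s m P i) : ℝ) *
        (β * supportWeight n (insert i (pointSupport P)).card) = 2 * δ := by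
    intro i
    have h : ∀ P ∈ (boundedSimplex d s m).filter (fun P => P i = m),
        (l1Dist P (arcTarget s m P i) : ℝ) *
          (β * supportWeight n (insert i (pointSupport P)).card) =
        2 * δ * β * (supportWeight n (pointSupport P).card : ℝ) := fun P hP => by
      obtain ⟨hP, hi⟩ := Finset.mem_filter.1 hP
      have hiS : i ∈ pointSupport P := mem_pointSupport.2 (by omega)
      rw [Finset.insert_eq_of_mem hiS, arcTarget, if_pos hi, l1Dist_corner hm hP hi]
      push_cast
      ring
    rw [Finset.sum_congr rfl h, ← Finset.mul_sum, ← Int.cast_sum,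
      sum_lower_supportWeight hm hδ hδ1, mul_assoc, hβ, mul_one]
  rw [Finset.sum_congr rfl hupper, Finset.sum_congr rfl fun i _ => hlower i, ← Finset.mul_sum,
    ← Int.cast_sum, Finset.sum_const, Finset.card_univ, Fintype.card_fin]
  have h := congrArg (Int.cast : ℤ → ℝ) (sum_upper_supportWeight (d := d) hm hδ n)
  push_cast at h ⊢
  rw [nsmul_eq_mul]
  push_cast
  linear_combination β / 2 * h

end SimplexFlow
end

/-! ### Choice of the parameters and evaluation of the cost -/

theorem mainTheorem2 (d s δ : ℕ) (hδ : 1 ≤ δ) (hs : 2 * δ ≤ s)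
    (hd : d = 2 ∨ (3 ≤ d ∧ (s : ℤ) = 3 * (δ : ℤ) - 2)) :
    ∃ u : Sym2 (SimplexVertex d s δ) → ℝ,
      (simplexInstance d s δ).IsMBCRSolution u ∧
      (∃ (b : SimplexVertex d s δ → ℝ)
          (f : SimplexVertex d s δ → SimplexVertex d s δ → SimplexVertex d s δ → ℝ),
        (simplexInstance d s δ).IsMBFRSolution u b f ∧
        ∀ r ∈ (simplexInstance d s δ).terminals, b r = -1) ∧
      (∃ u' : ℕ → ℝ, (∀ l, 0 ≤ u' l) ∧ (∀ l, l ≠ 1 → l ≠ 2 → u' l = 0) ∧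
        ∀ e ∈ (simplexInstance d s δ).graph.edgeSet, u e = u' (edgeLevel e)) ∧
      (d = 2 → (simplexInstance d s δ).totalCost u =
        3 * (s : ℝ) + 3 / 2 *
          ((((s : ℝ) - (δ : ℝ)) * ((s : ℝ) - (δ : ℝ) + 1)) /
            (2 * (s : ℝ) - 3 * (δ : ℝ) + 1))) ∧
      (3 ≤ d → (simplexInstance d s δ).totalCost u =
        (s : ℝ) / 3 * (5 * (d : ℝ) + 1 + ((d : ℝ) - 1) / (s : ℝ))) := by
  obtain ⟨m, hm⟩ : ∃ m, m + δ = s := ⟨s - δ, by omega⟩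
  have hδm : δ ≤ m := by omega
  set n : ℤ := 2 * m - s + 1 with hn
  have hn1 : 1 ≤ n := by omega
  -- From `s = 3 * δ - 2` it follows that `n = δ - 1` and `m = 2 * (δ - 1)`.
  have hd' : d = 2 ∨ ((s : ℤ) = 3 * n + 1 ∧ (m : ℤ) = 2 * n) := hd.imp_right fun h => by omega
  have hd2 : 2 ≤ d := by omega
  -- This is the unscaled total usage at a corner. The factor `1 / D` gives each corner total usage
  -- `1`.
  set D : ℤ := d * n + d.choose 2 * (δ - 1) with hD
  have hDpos : 0 < D := by
    have h₁ : 0 < (d : ℤ) * n := by positivity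
    have h₂ : 0 ≤ (d.choose 2 : ℤ) * (δ - 1) := mul_nonneg (by positivity) (by omega)
    omega
  have hDpos' : (0 : ℝ) < D := by exact_mod_cast hDpos
  have hβ : (1 / D : ℝ) * (D : ℝ) = 1 := one_div_mul_cancel hDpos'.ne'
  have hβ0 : (0 : ℝ) ≤ 1 / D := by positivity
  obtain ⟨b, f, hf, hb⟩ := exists_isMBFRSolution hm hδm hδ hn hn1 hd' hβ0 hβ
  refine ⟨simplexUsage n (1 / D), hf.isMBCRSolution, ⟨b, f, hf, hb⟩,
    ⟨fun l => 1 / D * supportWeight n (l + 1), fun l => ?_, fun l h₁ h₂ => ?_, fun e _ => rfl⟩,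
    fun h => ?_, fun h => ?_⟩
  · exact mul_nonneg hβ0 (Int.cast_nonneg (supportWeight_nonneg hn1 _))
  · simp [supportWeight, h₁, h₂]
  · rw [totalCost_simplexUsage hm hδm hδ hβ]
    subst h
    have hnR : (n : ℝ) = s - 2 * δ + 1 := by
      rw [hn, ← hm]
      push_cast
      ring
    have hDR : (D : ℝ) = 2 * s - 3 * δ + 1 := by
      rw [hD]
      push_cast [hnR]
      norm_num
      ring
    -- Eliminating `s` in favour of the denominator `D` leaves an identity of rational functions in
    -- `D` and `δ`.
    have hsD : (s : ℝ) = (D + 3 * δ - 1) / 2 := by linarith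
    have h₂ : (2 + 1).choose 2 = 3 := rfl
    have h₃ : (2 + 1).choose 3 = 1 := rfl
    rw [← hDR, hnR, h₂, h₃, hsD]
    push_cast
    field_simp
    ring
  · rw [totalCost_simplexUsage hm hδm hδ hβ]
    obtain ⟨-, hsδ⟩ := hd.resolve_left (by omega)
    have hsR : (s : ℝ) = 3 * δ - 2 := by exact_mod_cast hsδ
    have hnR : (n : ℝ) = δ - 1 := by
      have : n = δ - 1 := by omega
      exact_mod_cast this
    have hc₂ : ((d + 1).choose 2 : ℝ) = (d + 1) * d / 2 := by
      rw [Nat.cast_choose_two]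
      push_cast
      ring
    have hc₃ : ((d + 1).choose 3 : ℝ) = (d + 1) * d * (d - 1) / 6 := by
      have h₁ := Nat.add_one_mul_choose_eq d 2
      have h₂ : ((d + 1 : ℕ) : ℝ) * (d.choose 2 : ℝ) = ((d + 1).choose 3 : ℝ) * 3 := by
        exact_mod_cast h₁
      rw [Nat.cast_choose_two] at h₂
      push_cast at h₂
      linarith
    have hDR : (D : ℝ) = (δ - 1) * (d * (d + 1) / 2) := by
      rw [hD]
      push_cast [hnR]
      rw [Nat.cast_choose_two]
      ring
    -- `D` has the factor `δ - 1` and is positive, so `δ = 1` is excluded and the factor cancels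
    -- from the cost.
    have hδ1 : (δ : ℝ) - 1 ≠ 0 := fun h0 => by
      rw [hDR, h0, zero_mul] at hDpos'
      exact hDpos'.false
    have hd0 : (d : ℝ) ≠ 0 := by positivity
    have hd1 : (d : ℝ) + 1 ≠ 0 := by positivity
    have hs0 : (s : ℝ) ≠ 0 := by
      have : s ≠ 0 := by omega
      exact_mod_cast this
    have hrhs : (s : ℝ) / 3 * (5 * (d : ℝ) + 1 + ((d : ℝ) - 1) / (s : ℝ)) =
        (s * (5 * d + 1) + (d - 1)) / 3 := by
      field_simp
    rw [hrhs, hDR, hnR, hc₂, hc₃, hsR]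
    field_simp
    ring
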